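/- Let $n\ge 1$ and $\ell\in\{1,\dots,n\}$, and fix constants $K_\alpha$, one for each multi-index $\alpha\in\mathbb N_0^n$. There is a constant $C>0$, depending only on $n$, $\ell$ and the constants $K_\alpha$, with the following property. Let $\Omega\subset\mathbb R^n$ be a bounded domain that is star shaped with respect to a ball $B\subset\Omega$, i.e. for every $y\in\Omega$ the convex hull of $B\cup\{y\}$ is contained in $\Omega$. Set $R=\operatorname{diam}(\Omega)$, $\rho=\operatorname{diam}(B)$, and write $|\cdot|$ for Lebesgue measure. Let $\theta\in C_0^\infty(\mathbb R^n)$ be supported on $B$ with $$\int\theta\,dx=1,\qquad \|\partial^\alpha\theta\|_{L^1}\le \frac{K_\alpha}{\rho^{|\alpha|}},\qquad \|\partial^\alpha\theta\|_{L^\infty}\le\frac{K_\alpha}{\rho^{n+|\alpha|}}\qquad\text{for all }\alpha .$$ For a differential $\ell$-form $u=\sum_I u_I\,dx_I\in L^2(\Omega,\Lambda^\ell)$, i.e. with all $u_I\in L^2(\Omega)$ (the sum is over increasing $\ell$-tuples $I$), define the Bogovskiĭ-type operator $$\mathtt B_\ell u(x)=\int_\Omega G_\ell(x,y)\,(x-y)\lrcorner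 u(y)\,dy,\qquad G_\ell(x,y)=\int_1^\infty (t-1)^{n-\ell}t^{\ell-1}\theta(y+t(x-y))\,dt,$$ where $z\lrcorner\omega=\omega(z,\cdot,\dots,\cdot)$ denotes contraction. Then, for every $u\in L^2(\Omega,\Lambda^\ell)$, the integral defining $\mathtt B_\ell u(x)$ converges absolutely for almost every $x\in\Omega$, $\mathtt B_\ell u\in H^1(\Omega,\Lambda^{\ell-1})$, and $$|\mathtt B_\ell u|_{H^1(\Omega,\Lambda^{\ell-1})}\le C\,\frac R\rho\,\kappa\,\|u\|_{L^2(\Omega,\Lambda^\ell)},$$ where $\|u\|_{L^2(\Omega,\Lambda^\ell)}^2=\sum_I\|u_I\|_{L^2(\Omega)}^2$, $|v|_{H^1(\Omega,\Lambda^{\ell-1})}^2=\sum_J\sum_{j=1}^n\|\partial_j v_J\|_{L^2(\Omega)}^2$, and $$\kappa=1\quad\text{if }\ell<\tfrac n2+1,\qquad \kappa=1+\Bigl(\log\tfrac{|\Omega|}{|B|}\Bigr)^{\frac{n}{2(\ell-1)}}\Bigl(\tfrac{|\Omega|}{|B|}\Bigr)^{\frac{2(\ell-1)-n}{2(\ell-1)}}\quad\text{if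 }\ell\ge\tfrac n2+1 .$$ -/

import Mathlib

open MeasureTheory Set
open scoped ContDiff

noncomputable section

namespace BogForms

/-- `ℝⁿ` with its Euclidean structure. -/
abbrev E (n : ℕ) : Type := EuclideanSpace ℝ (Fin n)

/-- The `i`-th vector of the canonical basis of `ℝⁿ`. -/
def e {n : ℕ} (i : Fin n) : E n := EuclideanSpace.single i 1

/-- Exterior `ℓ`-forms: alternating `ℓ`-linear functions on `(ℝⁿ)^ℓ`. -/
abbrev Form (n ℓ : ℕ) : Type := E n [⋀^Fin ℓ]→L[ℝ] ℝ

/-- The coefficient `w_I = w(e_{i₁}, …, e_{i_ℓ})` of `dx_I`, for a strictly increasing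
`ℓ`-tuple `I` of indices. -/
def coeff {n ℓ : ℕ} (I : Fin ℓ ↪o Fin n) (w : Form n ℓ) : ℝ := w (fun k => e (I k))

/-- `Ω` contains `B` and contains the convex hull of `B ∪ {y}` for every `y ∈ Ω`. -/
def StarShapedWrt {n : ℕ} (Ω B : Set (E n)) : Prop :=
  B ⊆ Ω ∧ ∀ y ∈ Ω, convexHull ℝ (B ∪ {y}) ⊆ Ω

/-- The partial derivative `∂_{J 0} ⋯ ∂_{J (k-1)} θ (x)` of order `k`; every `∂^α` with `|α| = k`
is of this form. -/
def partialDeriv {n : ℕ} (k : ℕ) (J : Fin k → Fin n) (θ : E n → ℝ) (x : E n) : ℝ :=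
  iteratedFDeriv ℝ k θ x (fun i => e (J i))

/-- `θ` is a smooth function of integral one, supported on the ball `B` of centre `c` and radius
`r`, with `‖∂^α θ‖_{L¹} ≤ K_α / diam(B)^{|α|}` and `‖∂^α θ‖_{L^∞} ≤ K_α / diam(B)^{n + |α|}`
for all multi-indices `α`. -/
structure IsWeight {n : ℕ} (K : (k : ℕ) → (Fin k → Fin n) → ℝ) (c : E n) (r : ℝ)
    (θ : E n → ℝ) : Prop where
  smooth : ContDiff ℝ ∞ θ
  supp : tsupport θ ⊆ Metric.closedBall c r
  integral_eq_one : ∫ x, θ x = 1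
  l1_bound : ∀ (k : ℕ) (J : Fin k → Fin n),
    ∫ x, |partialDeriv k J θ x| ≤ K k J / Metric.diam (Metric.ball c r) ^ k
  sup_bound : ∀ (k : ℕ) (J : Fin k → Fin n) (x : E n),
    |partialDeriv k J θ x| ≤ K k J / Metric.diam (Metric.ball c r) ^ (n + k)

/-- The kernel `G_ℓ(x,y) = ∫_1^∞ (t-1)^{n-ℓ} t^{ℓ-1} θ(y + t(x-y)) dt`, for `1 ≤ ℓ ≤ n`. -/
def kernelG {n : ℕ} (ℓ : ℕ) (θ : E n → ℝ) (x y : E n) : ℝ :=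
  ∫ t in Ioi (1 : ℝ), (t - 1) ^ (n - ℓ) * t ^ (ℓ - 1) * θ (y + t • (x - y))

/-- `G_ℓ(x,y) (x-y) ⌟ u(y)` for an `ℓ`-form `u`, `ℓ = k + 1`. The contraction `z ⌟ w` is
`w(z, ·, …, ·)`. -/
def bogIntegrand {n k : ℕ} (θ : E n → ℝ) (u : E n → Form n (k + 1)) (x y : E n) : Form n k :=
  kernelG (k + 1) θ x y • (u y).curryLeft (x - y)

/-- The Bogovskii-type operator `B_ℓ`, `ℓ = k + 1`, applied to an `ℓ`-form `u` on `Ω`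
(extended by zero outside `Ω`). -/
def bogovskii {n k : ℕ} (θ : E n → ℝ) (Ω : Set (E n)) (u : E n → Form n (k + 1)) (x : E n) :
    Form n k :=
  ∫ y in Ω, bogIntegrand θ u x y

/-- `u ∈ L²(Ω, Λ^ℓ)`: all coefficients belong to `L²(Ω)`. -/
def MemL2 {n ℓ : ℕ} (Ω : Set (E n)) (u : E n → Form n ℓ) : Prop :=
  ∀ I : Fin ℓ ↪o Fin n, MemLp (fun x => coeff I (u x)) 2 (volume.restrict Ω)

/-- `‖u‖_{L²(Ω, Λ^ℓ)}`. -/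
def l2Norm {n ℓ : ℕ} (Ω : Set (E n)) (u : E n → Form n ℓ) : ℝ :=
  √(∑ I : Fin ℓ ↪o Fin n, ∫ x in Ω, coeff I (u x) ^ 2)

/-- `g ∈ L²(Ω)` is the weak partial derivative `∂_j f` on `Ω`. -/
def IsWeakPartial {n : ℕ} (Ω : Set (E n)) (j : Fin n) (f g : E n → ℝ) : Prop :=
  MemLp g 2 (volume.restrict Ω) ∧
    ∀ φ : E n → ℝ, ContDiff ℝ ∞ φ → HasCompactSupport φ → tsupport φ ⊆ Ω →
      ∫ x in Ω, f x * fderiv ℝ φ x (e j) = -∫ x in Ω, g x * φ x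

/-- `f ∈ H¹(Ω)`. -/
def MemH1 {n : ℕ} (Ω : Set (E n)) (f : E n → ℝ) : Prop :=
  MemLp f 2 (volume.restrict Ω) ∧ ∀ j : Fin n, ∃ g, IsWeakPartial Ω j f g

open Classical in
/-- A representative of the weak partial derivative `∂_j f ∈ L²(Ω)` (zero if there is none). -/
def weakPartial {n : ℕ} (Ω : Set (E n)) (j : Fin n) (f : E n → ℝ) : E n → ℝ :=
  if h : ∃ g, IsWeakPartial Ω j f g then h.choose else 0

/-- `v ∈ H¹(Ω, Λ^k)`: all coefficients belong to `H¹(Ω)`. -/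
def FormMemH1 {n k : ℕ} (Ω : Set (E n)) (v : E n → Form n k) : Prop :=
  ∀ I : Fin k ↪o Fin n, MemH1 Ω (fun x => coeff I (v x))

/-- `|v|_{H¹(Ω, Λ^k)}`, for `v ∈ H¹(Ω, Λ^k)`. -/
def h1Seminorm {n k : ℕ} (Ω : Set (E n)) (v : E n → Form n k) : ℝ :=
  √(∑ I : Fin k ↪o Fin n, ∑ j : Fin n,
    ∫ x in Ω, weakPartial Ω j (fun z => coeff I (v z)) x ^ 2)

open Classical in
/-- The factor `κ`, as a function of `n`, `ℓ` and the ratio `q = |Ω| / |B|`. -/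
def kappa (n ℓ : ℕ) (q : ℝ) : ℝ :=
  if (ℓ : ℝ) < (n : ℝ) / 2 + 1 then 1
  else 1 + (Real.log q) ^ ((n : ℝ) / (2 * ((ℓ : ℝ) - 1))) *
    q ^ ((2 * ((ℓ : ℝ) - 1) - (n : ℝ)) / (2 * ((ℓ : ℝ) - 1)))

end BogForms

end

noncomputable section

namespace BogForms

/-! ### Plancherel, weighted Cauchy–Schwarz and dilation of integrals -/

section

open scoped FourierTransform ENNReal
open SchwartzMap

/-! The derivatives of the operator are estimated by duality. For a scalar component `v` it is
enough to bound `∫ v ∂_jφ` by a multiple of the `L²` norm of the test function `φ`; the Riesz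
theorem then produces the weak derivative with the same bound (`exists_isWeakPartial_of_bound`).

Write `z = y + t(x - y)`. Since `(x - y)_i = ((z - c)_i - (y - c)_i) / t`, the factor `x - y` can be
shared between the bump function and the density: `∫ v ∂_jφ` becomes an integral over `t > 1`, with
weight `(t-1)^{n-ℓ} t^{ℓ-1} / t`, of the difference of two trilinear forms `pairing t η g ∂_jφ`
(`integral_bogScalar_mul`). In the first, `η = (· - c)_i θ` and the density is unchanged. In the
second, `η = θ` and the density carries the factor `(y - c)_i`, of size at most `R`. As `θ`
satisfies bounds worse by `1/ρ` than those of `(· - c)_i θ`, the second form is the origin of `R/ρ`.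

Each form is bounded in two regimes. For `t > 2`, where the kernel is singular at the diagonal,
Fourier transforms are used (`pairing_eq_fourier`): the derivative costs `|ξ|`, the decay of the
transform of `η` turns the multiplier into `|ξ| / (t² + ρ²|ξ|²)`, and this has an integral in `t`
bounded by `π/ρ` uniformly in `ξ`. Cauchy–Schwarz in `(t, ξ)` and Plancherel finish this part
(`lintegral_pairing_Ioi_two_le`).

For `1 < t ≤ 2` the derivative is moved onto `η` and a Schur test applies (`enorm_pairing_le`).
Integration in `x` costs `t^{-n} ≤ 1`, while integration in `y` costs `(t-1)^{-n}` or, using that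
`Ω` has finite measure, `|Ω|/ρ^n`. The integral of `(t-1)^{n-ℓ}` times the square root of the
minimum of these two is controlled by `κ` (`lintegral_min_le_kappa`).

Absolute convergence, membership in `L²` and the exchange of integrals come from a cruder bound: the
kernel is dominated by an integrable convolution kernel (`envelope`). Its size does not enter the
final constant. -/

/-- The Fourier integral of a function in `L¹ ∩ L²` has the same `L²` norm as the function. -/
theorem eLpNorm_fourier_eq {V : Type*} [NormedAddCommGroup V] [InnerProductSpace ℝ V]
    [FiniteDimensional ℝ V] [MeasurableSpace V] [BorelSpace V] {g : V → ℂ}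
    (h1 : Integrable g) (h2 : MemLp g 2) : eLpNorm (𝓕 g) 2 volume = eLpNorm g 2 volume := by
  set gL : Lp ℂ 2 (volume : Measure V) := h2.toLp g with hgL
  -- The `L²` Fourier transform and the Fourier integral are identified as distributions: tested
  -- against smooth compactly supported `Ψ`, both give `∫ 𝓕Ψ · g`.
  have key : ∀ᵐ x : V, (𝓕 gL : Lp ℂ 2 (volume : Measure V)) x = 𝓕 g x := by
    have hc : Continuous (𝓕 g) :=
      VectorFourier.fourierIntegral_continuous Real.continuous_fourierChar
        (by exact continuous_inner) h1
    apply ae_eq_of_integral_contDiff_smul_eq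
    · exact (Lp.memLp _).locallyIntegrable (by norm_num)
    · exact hc.locallyIntegrable
    intro ψ hψ hψc
    have hψ' : ContDiff ℝ ∞ (fun x => (ψ x : ℂ)) := Complex.ofRealCLM.contDiff.comp hψ
    have hψc' : HasCompactSupport (fun x => (ψ x : ℂ)) := hψc.comp_left (g := Complex.ofReal) rfl
    let Ψ : 𝓢(V, ℂ) := hψc'.toSchwartzMap hψ'
    have hΨ : ∀ x, Ψ x = (ψ x : ℂ) := fun x => rfl
    have e1 := congrArg (fun T => T Ψ) (Lp.fourier_toTemperedDistribution_eq gL)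
    simp only [TemperedDistribution.fourier_apply, Lp.toTemperedDistribution_apply] at e1
    have e2 : ∫ x, 𝓕 Ψ x • g x = ∫ x, Ψ x • 𝓕 g x := by
      have := VectorFourier.integral_fourierIntegral_smul_eq_flip (L := innerₗ V)
        (μ := (volume : Measure V)) (ν := volume)
        Real.continuous_fourierChar (by exact continuous_inner) Ψ.integrable h1
      simpa using! this
    have e3 : ∫ x, 𝓕 Ψ x • gL x = ∫ x, 𝓕 Ψ x • g x := by
      apply integral_congr_ae
      filter_upwards [h2.coeFn_toLp] with x hx
      rw [hgL, hx]
    rw [e3, e2] at e1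
    simpa [hΨ, Complex.real_smul] using! e1.symm
  rw [← eLpNorm_congr_ae key]
  have h3 := Lp.norm_fourier_eq gL
  have h4 := congrArg ENNReal.ofReal h3
  rw [Lp.norm_def, Lp.norm_def, ENNReal.ofReal_toReal (Lp.eLpNorm_ne_top _),
    ENNReal.ofReal_toReal (Lp.eLpNorm_ne_top _)] at h4
  rw [h4]
  exact eLpNorm_congr_ae h2.coeFn_toLp

theorem eLpNorm_two_sq {α F : Type*} [MeasurableSpace α] [ENorm F] (μ : Measure α)
    (f : α → F) : eLpNorm f 2 μ ^ 2 = ∫⁻ x, ‖f x‖ₑ ^ 2 ∂μ := by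
  have := eLpNorm_nnreal_pow_eq_lintegral (μ := μ) (f := f) (p := 2) (by norm_num)
  simpa only [NNReal.coe_ofNat, ENNReal.coe_ofNat, ENNReal.rpow_ofNat] using this

/-- The Cauchy–Schwarz inequality with a weight. -/
theorem lintegral_mul_mul_sq_le {α : Type*} [MeasurableSpace α] {μ : Measure α}
    {k f g : α → ℝ≥0∞} (hk : AEMeasurable k μ) (hf : AEMeasurable f μ) (hg : AEMeasurable g μ) :
    (∫⁻ x, k x * (f x * g x) ∂μ) ^ 2 ≤ (∫⁻ x, k x * f x ^ 2 ∂μ) * ∫⁻ x, k x * g x ^ 2 ∂μ := by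
  have h := ENNReal.lintegral_mul_le_Lp_mul_Lq μ Real.HolderConjugate.two_two
    (f := fun x => k x ^ (1 / 2 : ℝ) * f x) (g := fun x => k x ^ (1 / 2 : ℝ) * g x)
    ((hk.pow_const _).mul hf) ((hk.pow_const _).mul hg)
  have e : ∀ (a b : ℝ≥0∞), (a ^ (1 / 2 : ℝ) * b) ^ (2 : ℝ) = a * b ^ 2 := by
    intro a b
    rw [ENNReal.mul_rpow_of_nonneg _ _ (by norm_num), ← ENNReal.rpow_mul]
    norm_num
  have e' : ∀ a b c : ℝ≥0∞, (a ^ (1 / 2 : ℝ) * b) * (a ^ (1 / 2 : ℝ) * c) = a * (b * c) := by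
    intro a b c
    rw [mul_mul_mul_comm, ← ENNReal.rpow_add_of_nonneg _ _ (by norm_num) (by norm_num)]
    norm_num
  simp only [Pi.mul_apply, e, e'] at h
  calc _ ≤ ((∫⁻ x, k x * f x ^ 2 ∂μ) ^ (1 / 2 : ℝ) *
        (∫⁻ x, k x * g x ^ 2 ∂μ) ^ (1 / 2 : ℝ)) ^ 2 := by gcongr
    _ = _ := by
      rw [mul_pow, ← ENNReal.rpow_natCast, ← ENNReal.rpow_natCast, ← ENNReal.rpow_mul,
        ← ENNReal.rpow_mul]
      norm_num

theorem lintegral_comp_smul {V : Type*} [NormedAddCommGroup V] [NormedSpace ℝ V]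
    [FiniteDimensional ℝ V] [MeasurableSpace V] [BorelSpace V] (μ : Measure V)
    [μ.IsAddHaarMeasure] (f : V → ℝ≥0∞) {r : ℝ} (hr : r ≠ 0) :
    ∫⁻ x, f (r • x) ∂μ = ENNReal.ofReal |(r ^ Module.finrank ℝ V)⁻¹| * ∫⁻ x, f x ∂μ := by
  have := (Homeomorph.smulOfNeZero r hr).measurableEmbedding.lintegral_map (μ := μ) f
  simp only [Homeomorph.smulOfNeZero_apply] at this
  rw [← this, Measure.map_addHaar_smul μ hr, lintegral_smul_measure, smul_eq_mul]

end

/-! ### The trilinear form and its expression on the Fourier side -/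

section

open scoped FourierTransform ENNReal
open SchwartzMap

variable {n : ℕ}

/-- The trilinear form `∬ η(y + t(x-y)) g(y) D(x) dx dy`. -/
def pairing (t : ℝ) (η g D : E n → ℝ) : ℝ :=
  ∫ p : E n × E n, η (p.2 + t • (p.1 - p.2)) * (D p.1 * g p.2)

theorem integrable_pairing {t : ℝ} {η g D : E n → ℝ} (hη : Continuous η)
    (hηc : HasCompactSupport η) (hg : Integrable g) (hD : Integrable D) :
    Integrable fun p : E n × E n => η (p.2 + t • (p.1 - p.2)) * (D p.1 * g p.2) := by
  obtain ⟨C, hC⟩ := hηc.exists_bound_of_continuous hη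
  exact (hD.mul_prod hg).bdd_mul (c := C) (by fun_prop) (.of_forall fun p => hC _)

/-- The substitution is `x = t⁻¹(z + (t-1)y)`. Its phase depends on `y` only through the frequency
`(1 - t⁻¹)ξ`, which is where the transform of the density will be evaluated. -/
theorem integral_fourierChar_dilate (η : E n → ℂ) {t : ℝ} (ht : 0 < t) (y ξ : E n) :
    𝓕 (fun x => η (y + t • (x - y))) ξ =
      ((t ^ n)⁻¹ : ℝ) • (Real.fourierChar (-((1 - t⁻¹) * inner ℝ y ξ)) • 𝓕 η (t⁻¹ • ξ)) := by
  have e1 : ∀ x : E n, Real.fourierChar (-inner ℝ x ξ) • η (y + t • (x - y)) =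
      (fun z : E n => Real.fourierChar (-inner ℝ (t⁻¹ • (z + (t - 1) • y)) ξ) • η z)
        (t • x + (-((t - 1) • y))) := by
    intro x
    have h1 : t • x + -((t - 1) • y) = y + t • (x - y) := by module
    simp only [h1]
    congr 4
    rw [show y + t • (x - y) + (t - 1) • y = t • x by module, smul_smul, inv_mul_cancel₀ ht.ne',
      one_smul]
  rw [Real.fourier_eq, Real.fourier_eq]
  simp_rw [e1]
  rw [Measure.integral_comp_smul volume
    (fun x => (fun z : E n => Real.fourierChar (-inner ℝ (t⁻¹ • (z + (t - 1) • y)) ξ) • η z)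
        (x + (-((t - 1) • y)))), integral_add_right_eq_self
    (fun z : E n => Real.fourierChar (-inner ℝ (t⁻¹ • (z + (t - 1) • y)) ξ) • η z),
    finrank_euclideanSpace_fin, abs_of_pos (by positivity)]
  congr 1
  rw [Circle.smul_def, ← integral_smul]
  refine integral_congr_ae (.of_forall fun z => ?_)
  simp only [← Circle.smul_def, smul_smul]
  rw [← AddChar.map_add_eq_mul]
  congr 2
  rw [inner_smul_left, inner_add_left, inner_smul_left, inner_smul_right]
  simp
  field_simp
  ring

/-- Writing `D` as the transform of `w` lets the `x`-integral be moved onto the dilated bump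
function; the phase it acquires turns the remaining `y`-integral into a Fourier transform of `g`. -/
theorem pairing_eq_fourier {t : ℝ} (ht : 0 < t) {η g D : E n → ℝ} {w : E n → ℂ}
    (hη : Continuous η) (hηc : HasCompactSupport η) (hg : Integrable g) (hD : Integrable D)
    (hw : Integrable w) (hDw : ∀ x, (D x : ℂ) = 𝓕 w x) :
    (pairing t η g D : ℂ) = ∫ ξ, (((t ^ n)⁻¹ : ℝ) : ℂ) *
      (𝓕 (fun x => (η x : ℂ)) (t⁻¹ • ξ) * 𝓕 (fun x => (g x : ℂ)) ((1 - t⁻¹) • ξ) * w ξ) := by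
  have hηi : Integrable (fun x => (η x : ℂ)) := (hη.integrable_of_hasCompactSupport hηc).ofReal
  have hηF : Continuous (𝓕 (fun x => (η x : ℂ))) :=
      VectorFourier.fourierIntegral_continuous Real.continuous_fourierChar
        (by exact continuous_inner) hηi
  have inner_eq : ∀ y : E n, ∫ x, (η (y + t • (x - y)) : ℂ) * (D x : ℂ) =
      ∫ ξ, 𝓕 (fun x => (η (y + t • (x - y)) : ℂ)) ξ * w ξ := by
    intro y
    have hi : Integrable fun x => (η (y + t • (x - y)) : ℂ) := by
      have h1 : Integrable fun x : E n => (η (t • x) : ℂ) := hηi.comp_smul ht.ne'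
      have h2 := h1.comp_add_right (t⁻¹ • y - y)
      refine h2.congr (.of_forall fun x => ?_)
      simp only
      congr 2
      rw [smul_add, smul_sub, smul_smul, mul_inv_cancel₀ ht.ne', one_smul, smul_sub]
      abel
    have := VectorFourier.integral_fourierIntegral_smul_eq_flip (L := innerₗ (E n))
        (μ := (volume : Measure (E n))) (ν := volume)
        Real.continuous_fourierChar (by exact continuous_inner) hi hw
    simp_rw [hDw]
    simpa using! this.symm
  set m : E n → ℂ := fun ξ => 𝓕 (fun x => (η x : ℂ)) (t⁻¹ • ξ) * w ξ with hm
  have hmi : Integrable m := by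
    refine hw.bdd_mul (c := ∫ x, ‖(η x : ℂ)‖) (hηF.comp (by fun_prop)).aestronglyMeasurable
      (.of_forall fun ξ => ?_)
    exact VectorFourier.norm_fourierIntegral_le_integral_norm _ _ _ _ _
  have hgC : Integrable (fun x => (g x : ℂ)) := hg.ofReal
  -- The bilinear form is scaled by `1 - t⁻¹` in place of rescaling `ξ`, so the vanishing of this
  -- factor at `t = 1` needs no separate treatment.
  have flip := VectorFourier.integral_fourierIntegral_smul_eq_flip
      (L := (1 - t⁻¹) • innerₗ (E n))
      (μ := (volume : Measure (E n))) (ν := volume)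
      Real.continuous_fourierChar
      (by simpa using! continuous_const.mul continuous_inner) hgC (𝕜 := ℝ) (g := m) hmi
  have e3 : ∀ ξ, VectorFourier.fourierIntegral Real.fourierChar volume ((1 - t⁻¹) • innerₗ (E n))
      (fun x => (g x : ℂ)) ξ = 𝓕 (fun x => (g x : ℂ)) ((1 - t⁻¹) • ξ) := by
    intro ξ
    rw [Real.fourier_eq, VectorFourier.fourierIntegral]
    simp [inner_smul_right]
  have e4 : ∀ y, ((g y : ℝ) : ℂ) * ∫ x, (η (y + t • (x - y)) : ℂ) * (D x : ℂ) =
      (((t ^ n)⁻¹ : ℝ) : ℂ) * ((g y : ℂ) • VectorFourier.fourierIntegral Real.fourierChar volume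
        ((1 - t⁻¹) • innerₗ (E n)).flip m y) := by
    intro y
    rw [inner_eq]
    simp_rw [integral_fourierChar_dilate (fun x => (η x : ℂ)) ht y]
    rw [VectorFourier.fourierIntegral, smul_eq_mul, mul_left_comm]
    congr 1
    rw [← integral_const_mul]
    congr 1
    funext ξ
    simp [hm, Circle.smul_def, mul_assoc]
  calc (pairing t η g D : ℂ)
      = ∫ p : E n × E n, (η (p.2 + t • (p.1 - p.2)) : ℂ) * ((D p.1 : ℂ) * (g p.2 : ℂ)) := by
        rw [pairing, ← integral_complex_ofReal]
        push_cast
        rfl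
    _ = ∫ y, ∫ x, (η (y + t • (x - y)) : ℂ) * ((D x : ℂ) * (g y : ℂ)) := by
        rw [Measure.volume_eq_prod, integral_prod_symm]
        have := (integrable_pairing (t := t) hη hηc hg hD).ofReal (𝕜 := ℂ)
        simpa using! this
    _ = ∫ y, (((t ^ n)⁻¹ : ℝ) : ℂ) * ((g y : ℂ) • VectorFourier.fourierIntegral
        Real.fourierChar volume ((1 - t⁻¹) • innerₗ (E n)).flip m y) := by
        congr 1
        funext y
        rw [← e4, ← integral_const_mul]
        congr 1
        funext x
        ring
    _ = _ := by
        rw [integral_const_mul, integral_const_mul]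
        congr 1
        refine Eq.trans flip.symm (integral_congr_ae (.of_forall fun ξ => ?_))
        simp only [smul_eq_mul]
        rw [e3, hm]
        ring

end

/-! ### Large `t`: the estimate by Plancherel -/

section

open scoped FourierTransform ENNReal LineDeriv
open SchwartzMap

variable {n : ℕ}

/-- For `a > 0`, scaling `t` by `ρa` gives the density `1/(1+t²)`, and `a` cancels. This uniformity
in the frequency `a = ‖ξ‖` is what makes the region `t > 2` summable. -/
theorem lintegral_div_sq_add_sq_le {a ρ : ℝ} (ha : 0 ≤ a) (hρ : 0 < ρ) :
    ∫⁻ t : ℝ, ENNReal.ofReal (a / (t ^ 2 + ρ ^ 2 * a ^ 2)) ≤ ENNReal.ofReal (Real.pi / ρ) := by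
  rcases ha.eq_or_lt with rfl | ha
  · simp
  have hb : 0 < ρ * a := by positivity
  have e : ∀ t : ℝ, a / (t ^ 2 + ρ ^ 2 * a ^ 2) =
      a / (ρ * a) ^ 2 * (1 + (t / (ρ * a)) ^ 2)⁻¹ := by
    intro t
    field_simp
    ring
  simp_rw [e]
  rw [← ofReal_integral_eq_lintegral_ofReal]
  · rw [integral_const_mul, Measure.integral_comp_div (fun x => (1 + x ^ 2)⁻¹),
      integral_univ_inv_one_add_sq, abs_of_pos hb]
    refine le_of_eq (congrArg _ ?_)
    simp only [smul_eq_mul]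
    field_simp
  · exact (integrable_inv_one_add_sq.comp_div hb.ne').const_mul _
  · exact .of_forall fun t => by positivity

theorem eLpNorm_fourierInv_schwartz (Φ : 𝓢(E n, ℂ)) :
    eLpNorm (𝓕⁻ Φ : 𝓢(E n, ℂ)) 2 volume = eLpNorm Φ 2 volume := by
  rw [← eLpNorm_fourier_eq (𝓕⁻ Φ : 𝓢(E n, ℂ)).integrable ((𝓕⁻ Φ : 𝓢(E n, ℂ)).memLp 2), ← fourier_coe,
    FourierTransform.fourier_fourierInv_eq]

theorem norm_fourierInv_fderiv_le (Φ : 𝓢(E n, ℂ)) (j : Fin n) (ξ : E n) :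
    ‖(𝓕⁻ (∂_{e j} Φ)) ξ‖ ≤ 2 * Real.pi * ‖ξ‖ * ‖(𝓕⁻ Φ) ξ‖ := by
  have ht : (inner ℝ · (e j) : E n → ℝ).HasTemperateGrowth := by fun_prop
  rw [fourierInv_lineDerivOp_eq]
  have h : ‖inner ℝ ξ (e j)‖ ≤ ‖ξ‖ := by
    refine (norm_inner_le_norm _ _).trans ?_
    simp [e]
  simp only [smul_apply, smulLeftCLM_apply_apply ht, norm_smul]
  rw [← mul_assoc]
  gcongr
  simp [abs_of_pos Real.pi_pos]

theorem lintegral_lintegral_kernel_sq_le {k : ℝ → E n → ℝ≥0∞} {C0 : ℝ≥0∞}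
    (hkm : Measurable (Function.uncurry k)) (hkint : ∀ ξ, ∫⁻ t in Ioi (2 : ℝ), k t ξ ≤ C0)
    {F : E n → ℂ} (hF : Continuous F) :
    ∫⁻ t in Ioi (2 : ℝ), ∫⁻ ξ, k t ξ * ‖F ξ‖ₑ ^ 2 ≤ C0 * eLpNorm F 2 volume ^ 2 := by
  have hF2 : Measurable fun ξ => ‖F ξ‖ₑ ^ 2 := hF.measurable.enorm.pow_const 2
  rw [lintegral_lintegral_swap (hkm.mul (hF2.comp measurable_snd)).aemeasurable, eLpNorm_two_sq,
    ← lintegral_const_mul _ hF2]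
  refine lintegral_mono fun ξ => ?_
  have hm : Measurable fun t => k t ξ := hkm.comp measurable_prodMk_right
  simp only
  rw [lintegral_mul_const _ hm]
  exact mul_le_mul_left (hkint ξ) _

/-- A Cauchy–Schwarz estimate for a kernel which is integrable in the dilation parameter. -/
theorem lintegral_lintegral_dilate_le {k : ℝ → E n → ℝ≥0∞} {C0 : ℝ≥0∞}
    (hkm : Measurable (Function.uncurry k)) (hkint : ∀ ξ, ∫⁻ t in Ioi (2 : ℝ), k t ξ ≤ C0)
    (hkl : ∀ t l : ℝ, 1 / 2 ≤ l → l ≤ 1 → ∀ ξ, k t ξ ≤ ENNReal.ofReal 2 * k t (l • ξ))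
    {F G : E n → ℂ} (hF : Continuous F) (hG : Continuous G) :
    ∫⁻ t in Ioi (2 : ℝ), ∫⁻ ξ, k t ξ * (‖F ((1 - t⁻¹) • ξ)‖ₑ * ‖G ξ‖ₑ) ≤
      ENNReal.ofReal (2 ^ (n + 1)) * C0 * (eLpNorm F 2 volume * eLpNorm G 2 volume) := by
  have hm1 : Measurable fun p : ℝ × E n => ‖F ((1 - p.1⁻¹) • p.2)‖ₑ := by
    refine (hF.measurable.comp ?_).enorm
    fun_prop
  have hm2 : Measurable fun p : ℝ × E n => ‖G p.2‖ₑ :=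
    (hG.measurable.comp measurable_snd).enorm
  -- Cauchy–Schwarz is applied in `(t, ξ)` jointly, with `k` as weight; for fixed `t` the
  -- integrability of `k` in `t` could not be used.
  have cs := lintegral_mul_mul_sq_le (μ := (volume.restrict (Ioi (2 : ℝ))).prod
    (volume : Measure (E n))) (k := Function.uncurry k) hkm.aemeasurable
    hm1.aemeasurable hm2.aemeasurable
  rw [lintegral_prod _ (by fun_prop), lintegral_prod _ (by fun_prop),
    lintegral_prod _ (by fun_prop)] at cs
  simp only [Function.uncurry] at cs
  have b2 := lintegral_lintegral_kernel_sq_le hkm hkint hG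
  -- With `l = 1 - t⁻¹` in `[1/2, 1]`, passing from `ξ` to `l • ξ` costs `2` in the kernel and at
  -- most `2^n` in the Jacobian.
  have b1 : ∫⁻ t in Ioi (2 : ℝ), ∫⁻ ξ, k t ξ * ‖F ((1 - t⁻¹) • ξ)‖ₑ ^ 2 ≤
      ENNReal.ofReal (2 ^ (n + 1)) * (C0 * eLpNorm F 2 volume ^ 2) := by
    refine le_trans ?_ (mul_le_mul_right (lintegral_lintegral_kernel_sq_le hkm hkint hF) _)
    rw [← lintegral_const_mul' _ _ ENNReal.ofReal_ne_top]
    refine setLIntegral_mono' measurableSet_Ioi fun t ht => ?_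
    have ht : (2 : ℝ) < t := ht
    have ht0 : (0 : ℝ) < t := by linarith
    have hl : 1 / 2 ≤ 1 - t⁻¹ := by
      have : t⁻¹ ≤ 2⁻¹ := by gcongr
      linarith
    have hl' : 1 - t⁻¹ ≤ 1 := by
      have : 0 < t⁻¹ := by positivity
      linarith
    set l := 1 - t⁻¹
    have hl0 : 0 < l := by linarith
    calc ∫⁻ ξ, k t ξ * ‖F (l • ξ)‖ₑ ^ 2
        ≤ ∫⁻ ξ, (fun ζ => ENNReal.ofReal 2 * (k t ζ * ‖F ζ‖ₑ ^ 2)) (l • ξ) := by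
          refine lintegral_mono fun ξ => ?_
          simp only
          rw [← mul_assoc]
          exact mul_le_mul_left (hkl t l hl hl' ξ) _
      _ = ENNReal.ofReal |(l ^ n)⁻¹| *
          ∫⁻ ζ, ENNReal.ofReal 2 * (k t ζ * ‖F ζ‖ₑ ^ 2) := by
          rw [lintegral_comp_smul volume (fun ζ => ENNReal.ofReal 2 * (k t ζ * ‖F ζ‖ₑ ^ 2))
            hl0.ne', finrank_euclideanSpace_fin]
      _ ≤ _ := by
          rw [lintegral_const_mul' _ _ ENNReal.ofReal_ne_top, ← mul_assoc,
            ← ENNReal.ofReal_mul (by positivity), pow_succ]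
          gcongr
          rw [abs_of_pos (by positivity), ← inv_pow]
          gcongr
          rw [inv_le_comm₀ hl0 (by norm_num)]
          linarith
  -- Only the square root of `2^(n+1)` is needed; it is rounded up to `2^(n+1)`.
  have h1 : (1 : ℝ≥0∞) ≤ ENNReal.ofReal (2 ^ (n + 1)) := by
    rw [← ENNReal.ofReal_one]
    exact ENNReal.ofReal_le_ofReal (one_le_pow₀ (by norm_num))
  refine (ENNReal.pow_le_pow_left_iff (two_ne_zero)).1 (cs.trans ((mul_le_mul' b1 b2).trans ?_))
  calc _ = ENNReal.ofReal (2 ^ (n + 1)) * 1 *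
        (C0 * eLpNorm F 2 volume * eLpNorm G 2 volume) ^ 2 := by ring
    _ ≤ ENNReal.ofReal (2 ^ (n + 1)) * ENNReal.ofReal (2 ^ (n + 1)) *
        (C0 * eLpNorm F 2 volume * eLpNorm G 2 volume) ^ 2 := by gcongr
    _ = _ := by ring

/-- The part of the singular integral close to the diagonal. -/
theorem lintegral_pairing_Ioi_two_le {η g φ : E n → ℝ} {A ρ : ℝ} (hA : 0 ≤ A) (hρ : 0 < ρ)
    (hη : Continuous η) (hηc : HasCompactSupport η)
    (hdec : ∀ ξ, ‖𝓕 (fun x => (η x : ℂ)) ξ‖ ≤ A / (1 + ρ ^ 2 * ‖ξ‖ ^ 2))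
    (hg : Integrable g) (hg2 : MemLp g 2)
    (hφ : ContDiff ℝ ∞ φ) (hφc : HasCompactSupport φ) (j : Fin n) :
    ∫⁻ t in Ioi (2 : ℝ), ENNReal.ofReal (t ^ n / t ^ 2) *
        ‖pairing t η g (fun x => fderiv ℝ φ x (e j))‖ₑ ≤
      ENNReal.ofReal (2 ^ (n + 2) * Real.pi ^ 2 * (A / ρ)) *
        (eLpNorm g 2 volume * eLpNorm φ 2 volume) := by
  have hφ' : ContDiff ℝ ∞ (fun x => (φ x : ℂ)) := Complex.ofRealCLM.contDiff.comp hφ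
  have hφc' : HasCompactSupport (fun x => (φ x : ℂ)) := hφc.comp_left (g := Complex.ofReal) rfl
  let Φ : 𝓢(E n, ℂ) := hφc'.toSchwartzMap hφ'
  have hΦ : ∀ x, Φ x = (φ x : ℂ) := fun x => rfl
  set gc : E n → ℂ := fun x => (g x : ℂ) with hgc
  have hgci : Integrable gc := hg.ofReal
  have hgc2 : MemLp gc 2 := hg2.ofReal
  have hgF : Continuous (𝓕 gc) := VectorFourier.fourierIntegral_continuous
    Real.continuous_fourierChar (by exact continuous_inner) hgci
  set D : E n → ℝ := fun x => fderiv ℝ φ x (e j) with hD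
  have hDi : Integrable D := by
    refine Continuous.integrable_of_hasCompactSupport ?_ (hφc.fderiv_apply (𝕜 := ℝ) (e j))
    exact (hφ.continuous_fderiv (by simp)).clm_apply continuous_const
  have hDw : ∀ x, (D x : ℂ) = 𝓕 (𝓕⁻ (∂_{e j} Φ) : 𝓢(E n, ℂ)) x := by
    intro x
    rw [ FourierTransform.fourier_fourierInv_eq]
    change _ = fderiv ℝ (fun x => (φ x : ℂ)) x (e j)
    have := (Complex.ofRealCLM.hasFDerivAt.comp x
      (hφ.differentiable (by simp) x).hasFDerivAt).fderiv
    have h2 : fderiv ℝ (fun x => (φ x : ℂ)) x = Complex.ofRealCLM.comp (fderiv ℝ φ x) := this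
    rw [h2]
    rfl
  -- This is `t^{n-2} · t^{-n} · A / (1 + ρ²‖ξ‖²/t²) · 2π‖ξ‖`: weight, Jacobian, decay of the bump
  -- function and cost of the derivative.
  set k : ℝ → E n → ℝ≥0∞ :=
    fun t ξ => ENNReal.ofReal (2 * Real.pi * A * (‖ξ‖ / (t ^ 2 + ρ ^ 2 * ‖ξ‖ ^ 2))) with hk
  have hkm : Measurable (Function.uncurry k) := by
    simp only [hk, Function.uncurry_def]
    fun_prop
  have step : ∀ t ∈ Ioi (2 : ℝ), ENNReal.ofReal (t ^ n / t ^ 2) * ‖pairing t η g D‖ₑ ≤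
      ∫⁻ ξ, k t ξ * (‖𝓕 gc ((1 - t⁻¹) • ξ)‖ₑ * ‖(𝓕⁻ Φ) ξ‖ₑ) := by
    intro t ht
    have ht0 : (0 : ℝ) < t := lt_trans (by norm_num) ht
    have h1 := pairing_eq_fourier ht0 hη hηc hg hDi (𝓕⁻ (∂_{e j} Φ)).integrable 
      (by intro x; rw [hDw x, fourier_coe])
    have h2 : ‖pairing t η g D‖ₑ = ‖(pairing t η g D : ℂ)‖ₑ := by
      rw [← ofReal_norm, ← ofReal_norm, Complex.norm_real]
    rw [h2, h1]
    refine (mul_le_mul_right (enorm_integral_le_lintegral_enorm _) _).trans ?_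
    rw [← lintegral_const_mul' _ _ ENNReal.ofReal_ne_top]
    refine lintegral_mono fun ξ => ?_
    rw [← ofReal_norm, ← ofReal_norm, ← ofReal_norm, ← ENNReal.ofReal_mul (by positivity),
      ← ENNReal.ofReal_mul (by positivity), ← ENNReal.ofReal_mul (by positivity)]
    refine ENNReal.ofReal_le_ofReal ?_
    rw [norm_mul, norm_mul, norm_mul, Complex.norm_real, Real.norm_of_nonneg (by positivity)]
    have h3 := hdec (t⁻¹ • ξ)
    have h4 := norm_fourierInv_fderiv_le Φ j ξ
    calc t ^ n / t ^ 2 * ((t ^ n)⁻¹ * (‖𝓕 (fun x => (η x : ℂ)) (t⁻¹ • ξ)‖ *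
          ‖𝓕 gc ((1 - t⁻¹) • ξ)‖ * ‖(𝓕⁻ (∂_{e j} Φ)) ξ‖))
        ≤ t ^ n / t ^ 2 * ((t ^ n)⁻¹ * (A / (1 + ρ ^ 2 * ‖t⁻¹ • ξ‖ ^ 2) *
          ‖𝓕 gc ((1 - t⁻¹) • ξ)‖ * (2 * Real.pi * ‖ξ‖ * ‖(𝓕⁻ Φ) ξ‖))) := by
          gcongr
      _ = _ := by
          rw [norm_smul, norm_inv, Real.norm_of_nonneg ht0.le]
          field_simp
  refine (setLIntegral_mono' measurableSet_Ioi step).trans ?_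
  set C0 : ℝ≥0∞ := ENNReal.ofReal (2 * Real.pi * A * (Real.pi / ρ)) with hC0
  have hkint : ∀ ξ, ∫⁻ t in Ioi (2 : ℝ), k t ξ ≤ C0 := by
    intro ξ
    refine (setLIntegral_le_lintegral _ _).trans ?_
    simp only [hk, ENNReal.ofReal_mul (show 0 ≤ 2 * Real.pi * A by positivity), hC0]
    rw [lintegral_const_mul' _ _ ENNReal.ofReal_ne_top]
    gcongr
    exact lintegral_div_sq_add_sq_le (norm_nonneg _) hρ
  have hkl : ∀ t l : ℝ, 1 / 2 ≤ l → l ≤ 1 → ∀ ξ, k t ξ ≤ ENNReal.ofReal 2 * k t (l • ξ) := by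
    intro t l hl hl' ξ
    have hl0 : 0 < l := by linarith
    simp only [hk]
    rw [← ENNReal.ofReal_mul (by norm_num)]
    refine ENNReal.ofReal_le_ofReal ?_
    rw [norm_smul, Real.norm_of_nonneg hl0.le, mul_left_comm]
    refine mul_le_mul_of_nonneg_left ?_ (by positivity)
    rcases (norm_nonneg ξ).eq_or_lt with h0 | h0
    · simp [← h0]
    calc ‖ξ‖ / (t ^ 2 + ρ ^ 2 * ‖ξ‖ ^ 2)
        ≤ 2 * (l * ‖ξ‖) / (t ^ 2 + ρ ^ 2 * ‖ξ‖ ^ 2) := by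
          gcongr
          nlinarith
      _ ≤ 2 * (l * ‖ξ‖) / (t ^ 2 + ρ ^ 2 * (l * ‖ξ‖) ^ 2) := by
          gcongr
          nlinarith
      _ = _ := by ring
  have hgn : eLpNorm (𝓕 gc) 2 volume = eLpNorm g 2 volume := by
    rw [eLpNorm_fourier_eq hgci hgc2]
    exact eLpNorm_congr_norm_ae (.of_forall fun x => by simp [hgc])
  have hφn : eLpNorm (𝓕⁻ Φ : 𝓢(E n, ℂ)) 2 volume = eLpNorm φ 2 volume := by
    rw [eLpNorm_fourierInv_schwartz]
    exact eLpNorm_congr_norm_ae (.of_forall fun x => by simp [hΦ])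
  refine (lintegral_lintegral_dilate_le hkm hkint hkl hgF
    (𝓕⁻ Φ : 𝓢(E n, ℂ)).continuous).trans (le_of_eq ?_)
  rw [hgn, hφn, hC0, ← ENNReal.ofReal_mul (by positivity)]
  congr 2
  ring

end

/-! ### Fixed `t`: integration by parts and the Schur test -/

section

open scoped FourierTransform ENNReal

variable {n : ℕ}

theorem hasFDerivAt_comp_dilate {η : E n → ℝ} (hη : Differentiable ℝ η) (t : ℝ) (y x : E n) :
    HasFDerivAt (fun x => η (y + t • (x - y))) (t • fderiv ℝ η (y + t • (x - y))) x := by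
  have h1 : HasFDerivAt (fun x : E n => y + t • (x - y))
      (t • ContinuousLinearMap.id ℝ (E n)) x :=
    (((hasFDerivAt_id x).sub_const y).const_smul t).const_add y
  have h2 := (hη (y + t • (x - y))).hasFDerivAt.comp x h1
  refine h2.congr_fderiv ?_
  ext v
  simp

/-- Integration by parts in `x` for fixed `y`. The chain rule factor `t` will cancel the `1/t` left
over from splitting `x - y`. -/
theorem pairing_fderiv (t : ℝ) {η g φ : E n → ℝ}
    (hη : ContDiff ℝ ∞ η) (hηc : HasCompactSupport η) (hg : Integrable g)
    (hφ : ContDiff ℝ ∞ φ) (hφc : HasCompactSupport φ) (j : Fin n) :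
    pairing t η g (fun x => fderiv ℝ φ x (e j)) =
      -(t * pairing t (fun x => fderiv ℝ η x (e j)) g φ) := by
  have hφ1 : Continuous fun x => fderiv ℝ φ x (e j) :=
    (hφ.continuous_fderiv (by simp)).clm_apply continuous_const
  have hη1 : Continuous fun x => fderiv ℝ η x (e j) :=
    (hη.continuous_fderiv (by simp)).clm_apply continuous_const
  have hDc := hφc.fderiv_apply (𝕜 := ℝ) (e j)
  have hηDc := hηc.fderiv_apply (𝕜 := ℝ) (e j)
  have hDi : Integrable fun x => fderiv ℝ φ x (e j) :=
    hφ1.integrable_of_hasCompactSupport hDc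
  have hφi : Integrable φ := hφ.continuous.integrable_of_hasCompactSupport hφc
  rw [pairing, pairing, Measure.volume_eq_prod,
    integral_prod_symm _ (by exact integrable_pairing hη.continuous hηc hg hDi),
    integral_prod_symm _ (by exact integrable_pairing hη1 hηDc hg hφi), ← integral_const_mul,
    ← integral_neg]
  congr 1
  funext y
  simp only
  have hyd := hasFDerivAt_comp_dilate (hη.differentiable (by simp)) t y
  have hc : Continuous fun x : E n => y + t • (x - y) := by fun_prop
  have key := integral_mul_fderiv_eq_neg_fderiv_mul_of_integrable
    (μ := (volume : Measure (E n))) (f := fun x => η (y + t • (x - y))) (g := φ) (v := e j)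
    ?_ ?_ ?_ (fun x _ => (hyd x).differentiableAt)
    (fun x _ => hφ.differentiable (by simp) x)
  · calc ∫ x, η (y + t • (x - y)) * (fderiv ℝ φ x (e j) * g y)
        = (∫ x, η (y + t • (x - y)) * fderiv ℝ φ x (e j)) * g y := by
          rw [← integral_mul_const]
          simp only [mul_assoc]
      _ = -(t * ∫ x, fderiv ℝ η (y + t • (x - y)) (e j) * (φ x * g y)) := by
          rw [key]
          simp only [(hyd _).fderiv, smul_apply, smul_eq_mul]
          rw [neg_mul, ← integral_mul_const, ← integral_const_mul]
          simp only [mul_assoc]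
  · simp only [(hyd _).fderiv, smul_apply, smul_eq_mul]
    exact ((continuous_const.mul (hη1.comp hc)).mul hφ.continuous).integrable_of_hasCompactSupport
      hφc.mul_left
  · exact ((hη.continuous.comp hc).mul hφ1).integrable_of_hasCompactSupport hDc.mul_left
  · exact ((hη.continuous.comp hc).mul hφ.continuous).integrable_of_hasCompactSupport hφc.mul_left

theorem lintegral_dilate_left (f : E n → ℝ≥0∞) {t : ℝ} (ht : 0 < t) (y : E n) :
    ∫⁻ x, f (y + t • (x - y)) = ENNReal.ofReal (t ^ n)⁻¹ * ∫⁻ x, f x := by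
  rw [lintegral_sub_right_eq_self (fun x => f (y + t • x)) y,
    lintegral_comp_smul volume (fun x => f (y + x)) ht.ne', lintegral_add_left_eq_self,
    finrank_euclideanSpace_fin, abs_of_pos (by positivity)]

theorem lintegral_dilate_right (f : E n → ℝ≥0∞) {t : ℝ} (ht : 1 < t) (x : E n) :
    ∫⁻ y, f (y + t • (x - y)) = ENNReal.ofReal ((t - 1) ^ n)⁻¹ * ∫⁻ x, f x := by
  have e1 : ∀ y : E n, y + t • (x - y) = (1 - t) • y + t • x := by
    intro y
    module
  simp_rw [e1]
  rw [lintegral_comp_smul volume (fun y => f (y + t • x)) (by linarith : 1 - t ≠ 0),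
    lintegral_add_right_eq_self, finrank_euclideanSpace_fin, abs_inv, abs_pow, abs_sub_comm,
    abs_of_pos (by linarith)]

/-- A Schur test with different row and column bounds: Cauchy–Schwarz with weight `|ψ(y + t(x-y))|`
yields the square root of their product. The minimum sits in the row bound, where two estimates
compete. -/
theorem enorm_pairing_le {t : ℝ} (ht : 1 < t) {ψ g φ : E n → ℝ} {Ω : Set (E n)} {M Q : ℝ}
    (hΩ : MeasurableSet Ω) (hM : 0 ≤ M) (hQ : 0 ≤ Q) (hψ : Continuous ψ)
    (hψ1 : ∫⁻ x, ‖ψ x‖ₑ ≤ ENNReal.ofReal M)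
    (hψΩ : ∀ x, ‖ψ x‖ₑ * volume Ω ≤ ENNReal.ofReal (M * Q))
    (hgm : AEStronglyMeasurable g) (hgΩ : ∀ y ∉ Ω, g y = 0) (hφ : Continuous φ) :
    ‖pairing t ψ g φ‖ₑ ≤ ENNReal.ofReal (M * √(min ((t - 1) ^ n)⁻¹ Q)) *
      (eLpNorm g 2 volume * eLpNorm φ 2 volume) := by
  have ht0 : 0 < t := by linarith
  have hc : Continuous fun p : E n × E n => p.2 + t • (p.1 - p.2) := by fun_prop
  set N : ℝ := min ((t - 1) ^ n)⁻¹ Q with hN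
  have hN0 : 0 ≤ N := by
    have : 0 < t - 1 := by linarith
    positivity
  set k : E n × E n → ℝ≥0∞ := fun p => ‖ψ (p.2 + t • (p.1 - p.2))‖ₑ * Ω.indicator 1 p.2 with hk
  have hkm : Measurable k := by
    refine ((hψ.measurable.comp hc.measurable).enorm).mul ?_
    exact (measurable_one.indicator hΩ).comp measurable_snd
  have h1 : ‖pairing t ψ g φ‖ₑ ≤
      ∫⁻ p : E n × E n, k p * (‖φ p.1‖ₑ * ‖g p.2‖ₑ) := by
    refine (enorm_integral_le_lintegral_enorm _).trans (lintegral_mono fun p => ?_)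
    simp only [hk]
    by_cases hp : p.2 ∈ Ω
    · simp [hp, enorm_mul]
    · simp [hgΩ _ hp]
  have hgm' : AEMeasurable (fun p : E n × E n => ‖g p.2‖ₑ) := hgm.comp_snd.enorm
  have cs := lintegral_mul_mul_sq_le (μ := (volume : Measure (E n × E n))) hkm.aemeasurable
    (f := fun p => ‖φ p.1‖ₑ) (hφ.measurable.comp measurable_fst).enorm.aemeasurable hgm'
  -- Integration over `y` has Jacobian `(t-1)^{-n}`, which degenerates as `t → 1`; there the
  -- supremum of `ψ` times `|Ω|` is used instead.
  have b1 : ∫⁻ p : E n × E n, k p * ‖φ p.1‖ₑ ^ 2 ≤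
      ENNReal.ofReal (M * N) * eLpNorm φ 2 volume ^ 2 := by
    rw [Measure.volume_eq_prod, lintegral_prod _ (by
      exact (hkm.mul ((hφ.measurable.comp measurable_fst).enorm.pow_const 2)).aemeasurable),
      eLpNorm_two_sq, ← lintegral_const_mul' _ _ ENNReal.ofReal_ne_top]
    refine lintegral_mono fun x => ?_
    have hmx : Measurable fun y => k (x, y) := hkm.comp measurable_prodMk_left
    simp only
    rw [lintegral_mul_const _ hmx]
    refine mul_le_mul_left ?_ _
    rw [hN, mul_min_of_nonneg _ _ hM, ENNReal.ofReal_min]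
    refine le_min ?_ ?_
    · calc ∫⁻ y, k (x, y) ≤ ∫⁻ y, (fun z => ‖ψ z‖ₑ) (y + t • (x - y)) := by
            refine lintegral_mono fun y => ?_
            simp only [hk]
            refine mul_le_of_le_one_right' ?_
            by_cases hy : y ∈ Ω <;> simp [hy]
        _ ≤ _ := by
            rw [lintegral_dilate_right (fun z => ‖ψ z‖ₑ) ht, mul_comm M, ENNReal.ofReal_mul (by
              have : 0 < t - 1 := by linarith
              positivity)]
            gcongr
    · calc ∫⁻ y, k (x, y) ≤ ∫⁻ y, Ω.indicator (fun _ => ⨆ z, ‖ψ z‖ₑ) y := by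
            refine lintegral_mono fun y => ?_
            simp only [hk]
            by_cases hy : y ∈ Ω
            · simp only [hy, indicator_of_mem, Pi.one_apply, mul_one]
              exact le_iSup (fun z => ‖ψ z‖ₑ) _
            · simp [hy]
        _ ≤ _ := by
            rw [lintegral_indicator hΩ, setLIntegral_const, ENNReal.iSup_mul]
            exact iSup_le hψΩ
  -- Integration over `x` has Jacobian `t^{-n} ≤ 1`, so this bound is uniform in `t`.
  have b2 : ∫⁻ p : E n × E n, k p * ‖g p.2‖ₑ ^ 2 ≤
      ENNReal.ofReal M * eLpNorm g 2 volume ^ 2 := by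
    rw [Measure.volume_eq_prod, lintegral_prod_symm _ (by
      exact hkm.aemeasurable.mul (hgm'.pow_const 2)),
      eLpNorm_two_sq, ← lintegral_const_mul' _ _ ENNReal.ofReal_ne_top]
    refine lintegral_mono fun y => ?_
    have hmy : Measurable fun x => k (x, y) := hkm.comp measurable_prodMk_right
    simp only
    rw [lintegral_mul_const _ hmy]
    refine mul_le_mul_left ?_ _
    calc ∫⁻ x, k (x, y) ≤ ∫⁻ x, (fun z => ‖ψ z‖ₑ) (y + t • (x - y)) := by
            refine lintegral_mono fun x => ?_
            simp only [hk]
            refine mul_le_of_le_one_right' ?_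
            by_cases hy : y ∈ Ω <;> simp [hy]
        _ ≤ 1 * ENNReal.ofReal M := by
            rw [lintegral_dilate_left (fun z => ‖ψ z‖ₑ) ht0]
            gcongr
            rw [← ENNReal.ofReal_one]
            exact ENNReal.ofReal_le_ofReal (inv_le_one_of_one_le₀ (one_le_pow₀ ht.le))
        _ = _ := one_mul _
  refine h1.trans ((ENNReal.pow_le_pow_left_iff two_ne_zero).1
    (cs.trans ((mul_le_mul' b1 b2).trans (le_of_eq ?_))))
  have hsq : ENNReal.ofReal (M * √N) ^ 2 = ENNReal.ofReal (M * N) * ENNReal.ofReal M := by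
    rw [← ENNReal.ofReal_pow (by positivity), ← ENNReal.ofReal_mul (by positivity), mul_pow,
      Real.sq_sqrt hN0]
    congr 1
    ring
  rw [mul_pow, hsq, mul_pow]
  ring

end

/-! ### One-dimensional integrals and the factor `κ` -/

section

open scoped ENNReal

theorem setLIntegral_rpow_Ioc {a b r : ℝ} (ha : 0 ≤ a) (hab : a ≤ b)
    (h : -1 < r ∨ (r ≠ -1 ∧ 0 < a)) :
    ∫⁻ τ in Ioc a b, ENNReal.ofReal (τ ^ r) =
      ENNReal.ofReal ((b ^ (r + 1) - a ^ (r + 1)) / (r + 1)) := by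
  have hor : -1 < r ∨ r ≠ -1 ∧ (0 : ℝ) ∉ uIcc a b := by
    refine h.imp_right fun h => ⟨h.1, ?_⟩
    rw [uIcc_of_le hab]
    exact fun h0 => absurd h0.1 (not_le.2 h.2)
  rw [← integral_rpow hor, intervalIntegral.integral_of_le hab,
    ofReal_integral_eq_lintegral_ofReal]
  · rw [← IntegrableOn, ← intervalIntegrable_iff_integrableOn_Ioc_of_le hab]
    rcases hor with h | h
    · exact intervalIntegral.intervalIntegrable_rpow' h
    · exact intervalIntegral.intervalIntegrable_rpow (Or.inr h.2)
  · filter_upwards [ae_restrict_mem measurableSet_Ioc] with τ hτ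
    exact Real.rpow_nonneg (ha.trans hτ.1.le) _

theorem setLIntegral_inv_Ioc {a b : ℝ} (ha : 0 < a) (hab : a ≤ b) :
    ∫⁻ τ in Ioc a b, ENNReal.ofReal τ⁻¹ = ENNReal.ofReal (Real.log (b / a)) := by
  have h0 : (0 : ℝ) ∉ uIcc a b := by
    rw [uIcc_of_le hab]
    exact fun h0 => absurd h0.1 (not_le.2 ha)
  rw [← integral_inv_of_pos ha (ha.trans_le hab), intervalIntegral.integral_of_le hab,
    ofReal_integral_eq_lintegral_ofReal]
  · rw [← IntegrableOn, ← intervalIntegrable_iff_integrableOn_Ioc_of_le hab]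
    exact intervalIntegral.intervalIntegrable_inv (fun x hx h => h0 (h ▸ hx)) continuousOn_id
  · filter_upwards [ae_restrict_mem measurableSet_Ioc] with τ hτ
    exact inv_nonneg.2 (ha.le.trans hτ.1.le)

theorem one_le_kappa (n ℓ : ℕ) {q : ℝ} (hq : 1 ≤ q) : 1 ≤ kappa n ℓ q := by
  unfold kappa
  split_ifs with h
  · exact le_rfl
  · have h1 := Real.log_nonneg hq
    have : 0 ≤ (Real.log q) ^ ((n : ℝ) / (2 * ((ℓ : ℝ) - 1))) *
      q ^ ((2 * ((ℓ : ℝ) - 1) - (n : ℝ)) / (2 * ((ℓ : ℝ) - 1))) := by positivity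
    linarith

/-- For `n < 2k` the factor `κ` dominates `q ^ ((2k - n) / (2n))`. -/
theorem rpow_le_exp_mul_kappa {n k : ℕ} (hk : k + 1 ≤ n) (h2 : n ≤ 2 * k) {q : ℝ} (hq : 1 ≤ q) :
    q ^ ((2 * (k : ℝ) - n) / (2 * n)) ≤ Real.exp 1 * kappa n (k + 1) q := by
  have hn : (0 : ℝ) < n := by exact_mod_cast (by omega : 0 < n)
  have hk0 : (0 : ℝ) < k := by exact_mod_cast (by omega : 0 < k)
  have hkn : (k : ℝ) ≤ n := by exact_mod_cast (by omega : k ≤ n)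
  have h2' : (n : ℝ) ≤ 2 * k := by exact_mod_cast h2
  have hq0 : 0 < q := by linarith
  have hlog := Real.log_nonneg hq
  have hexp : (2 * (k : ℝ) - n) / (2 * n) ≤ (2 * (k : ℝ) - n) / (2 * k) := by
    apply div_le_div_of_nonneg_left <;> linarith
  have he : (1 : ℝ) ≤ Real.exp 1 := Real.one_le_exp (by norm_num)
  have hκ : kappa n (k + 1) q = 1 + (Real.log q) ^ ((n : ℝ) / (2 * k)) *
      q ^ ((2 * (k : ℝ) - n) / (2 * k)) := by
    have : ¬ (((k + 1 : ℕ) : ℝ) < (n : ℝ) / 2 + 1) := by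
      push_cast
      linarith
    rw [kappa, if_neg this]
    push_cast
    simp only [add_sub_cancel_right]
  have h1κ := one_le_kappa n (k + 1) hq
  -- If `log q < 1` the logarithm in `κ` may be too small to help, but then `q ≤ e` and the summand
  -- `1` of `κ` suffices; hence the factor `e`.
  rcases le_or_gt 1 (Real.log q) with hL | hL
  · calc q ^ ((2 * (k : ℝ) - n) / (2 * n)) ≤ 1 * q ^ ((2 * (k : ℝ) - n) / (2 * k)) := by
          rw [one_mul]
          exact Real.rpow_le_rpow_of_exponent_le hq hexp
      _ ≤ (Real.log q) ^ ((n : ℝ) / (2 * k)) * q ^ ((2 * (k : ℝ) - n) / (2 * k)) := by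
          gcongr
          exact Real.one_le_rpow hL (by positivity)
      _ ≤ kappa n (k + 1) q := by
          rw [hκ]
          linarith
      _ ≤ _ := le_mul_of_one_le_left (by linarith) he
  · have hqe : q ≤ Real.exp 1 := by
      rw [← Real.log_le_iff_le_exp hq0]
      exact hL.le
    have : (2 * (k : ℝ) - n) / (2 * n) ≤ 1 := by
      rw [div_le_one (by positivity)]
      linarith
    calc q ^ ((2 * (k : ℝ) - n) / (2 * n)) ≤ q ^ (1 : ℝ) :=
          Real.rpow_le_rpow_of_exponent_le hq this
      _ ≤ Real.exp 1 * 1 := by simpa using hqe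
      _ ≤ _ := by gcongr

/-- The one-dimensional integral which produces the factor `κ`. -/
theorem lintegral_min_le_kappa {n k : ℕ} (hk : k + 1 ≤ n) {c q Q : ℝ} (hc : 1 ≤ c) (hq : 1 ≤ q)
    (hQ : Q ≤ c * q) :
    ∫⁻ τ in Ioc (0 : ℝ) 1, ENNReal.ofReal (τ ^ (n - (k + 1)) * √(min (τ ^ n)⁻¹ Q)) ≤
      ENNReal.ofReal ((√c + 2) * Real.exp 1 * kappa n (k + 1) q) := by
  obtain ⟨m, rfl⟩ : ∃ m, n = m + (k + 1) := ⟨n - (k + 1), by omega⟩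
  rw [Nat.add_sub_cancel]
  set n := m + (k + 1) with hnm
  have hnpos : 0 < n := by omega
  have hn : (0 : ℝ) < n := by exact_mod_cast hnpos
  have hnR : (n : ℝ) = m + (k + 1) := by rw [hnm]; push_cast; ring
  have hκ := one_le_kappa n (k + 1) hq
  have hsc : 1 ≤ √c := Real.one_le_sqrt.2 hc
  have he : (1 : ℝ) ≤ Real.exp 1 := Real.one_le_exp (by norm_num)
  have hq0 : 0 < q := by linarith
  have pw : ∀ τ : ℝ, 0 < τ → τ ^ m * √((τ ^ n)⁻¹) = τ ^ ((m : ℝ) - n / 2) := by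
    intro τ hτ
    rw [Real.sqrt_eq_rpow, ← Real.rpow_natCast, ← Real.rpow_natCast, ← Real.rpow_neg hτ.le,
      ← Real.rpow_mul hτ.le, ← Real.rpow_add hτ]
    congr 1
    ring
  rcases Nat.lt_or_ge (2 * k) n with h | h
  -- Integrality turns `2k < n` into `2k + 1 ≤ n`, so the exponent `m - n/2 = n/2 - k - 1` is at
  -- least `-1/2` and `(t-1)^{-n}` alone is integrable enough.
  · have h' : (2 * k + 1 : ℝ) ≤ n := by exact_mod_cast h
    calc ∫⁻ τ in Ioc (0 : ℝ) 1, ENNReal.ofReal (τ ^ m * √(min (τ ^ n)⁻¹ Q))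
        ≤ ∫⁻ τ in Ioc (0 : ℝ) 1, ENNReal.ofReal (τ ^ (-(1 / 2) : ℝ)) := by
          refine setLIntegral_mono' measurableSet_Ioc fun τ hτ => ENNReal.ofReal_le_ofReal ?_
          have hτ0 : 0 < τ := hτ.1
          calc τ ^ m * √(min (τ ^ n)⁻¹ Q) ≤ τ ^ m * √((τ ^ n)⁻¹) := by
                gcongr
                exact min_le_left _ _
            _ = τ ^ ((m : ℝ) - n / 2) := pw τ hτ0
            _ ≤ τ ^ (-(1 / 2) : ℝ) :=
                Real.rpow_le_rpow_of_exponent_ge hτ0 hτ.2 (by linarith)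
      _ = ENNReal.ofReal 2 := by
          rw [setLIntegral_rpow_Ioc le_rfl zero_le_one (Or.inl (by norm_num))]
          norm_num
      _ ≤ _ := by
          refine ENNReal.ofReal_le_ofReal ?_
          nlinarith [mul_nonneg (sub_nonneg.2 he) (sub_nonneg.2 hκ),
            mul_le_mul he hκ zero_le_one (by linarith)]
  · have h' : (n : ℝ) ≤ 2 * k := by exact_mod_cast h
    -- The crossover point where `τ^{-n} = q`: the bound by `|Ω|` is used below it, the Jacobian
    -- above it.
    set τ0 : ℝ := q ^ (-(1 / n) : ℝ) with hτ0
    have hτ0pos : 0 < τ0 := Real.rpow_pos_of_pos hq0 _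
    have hτ01 : τ0 ≤ 1 := Real.rpow_le_one_of_one_le_of_nonpos hq (by
      have : 0 < 1 / (n : ℝ) := by positivity
      linarith)
    set a : ℝ := 2 * k - n with ha
    have ha0 : 0 ≤ a := by linarith
    have bound1 : ∫⁻ τ in Ioc (0 : ℝ) τ0, ENNReal.ofReal (τ ^ m * √(min (τ ^ n)⁻¹ Q)) ≤
        ENNReal.ofReal (√c * q ^ (a / (2 * n))) := by
      calc ∫⁻ τ in Ioc (0 : ℝ) τ0, ENNReal.ofReal (τ ^ m * √(min (τ ^ n)⁻¹ Q))
          ≤ ∫⁻ τ in Ioc (0 : ℝ) τ0, ENNReal.ofReal (τ0 ^ m * √(c * q)) := by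
            refine setLIntegral_mono' measurableSet_Ioc fun τ hτ => ENNReal.ofReal_le_ofReal ?_
            have := hτ.1.le
            have := hτ.2
            gcongr
            exact (min_le_right _ _).trans hQ
        _ = ENNReal.ofReal (τ0 ^ m * √(c * q) * τ0) := by
            rw [setLIntegral_const, Real.volume_Ioc, sub_zero, ENNReal.ofReal_mul (by positivity),
              ENNReal.ofReal_mul (by positivity), ENNReal.ofReal_mul (by positivity)]
        _ = _ := by
            congr 1
            rw [Real.sqrt_mul (by linarith), mul_left_comm, mul_assoc]
            congr 1
            rw [mul_right_comm, ← pow_succ, hτ0, ← Real.rpow_natCast, ← Real.rpow_mul hq0.le,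
              Real.sqrt_eq_rpow, ← Real.rpow_add hq0]
            congr 1
            rw [ha]
            field_simp
            push_cast
            linarith
    have bound2 : ∀ τ ∈ Ioc τ0 1, τ ^ m * √(min (τ ^ n)⁻¹ Q) ≤ τ ^ (-1 - a / 2) := by
      intro τ hτ
      have hτp : 0 < τ := hτ0pos.trans hτ.1
      calc τ ^ m * √(min (τ ^ n)⁻¹ Q) ≤ τ ^ m * √((τ ^ n)⁻¹) := by
            gcongr
            exact min_le_left _ _
        _ = τ ^ ((m : ℝ) - n / 2) := pw τ hτp
        _ = _ := by
            congr 1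
            rw [ha]
            linarith
    have split : ∫⁻ τ in Ioc (0 : ℝ) 1, ENNReal.ofReal (τ ^ m * √(min (τ ^ n)⁻¹ Q)) ≤
        ENNReal.ofReal (√c * q ^ (a / (2 * n))) +
          ∫⁻ τ in Ioc τ0 1, ENNReal.ofReal (τ ^ (-1 - a / 2)) := by
      rw [← Ioc_union_Ioc_eq_Ioc hτ0pos.le hτ01]
      refine (lintegral_union_le _ _ _).trans (add_le_add bound1 ?_)
      exact setLIntegral_mono' measurableSet_Ioc fun τ hτ =>
        ENNReal.ofReal_le_ofReal (bound2 τ hτ)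
    refine split.trans ?_
    -- When `n = 2k` the outer integrand is `τ⁻¹`, whose integral is a logarithm, and `κ` is exactly
    -- `1 + log q`.
    rcases ha0.eq_or_lt with ha' | ha'
    · rw [← ha']
      simp only [zero_div, Real.rpow_zero, sub_zero, mul_one]
      have hinv : ∫⁻ τ in Ioc τ0 1, ENNReal.ofReal (τ ^ (-1 : ℝ)) =
          ENNReal.ofReal (Real.log (1 / τ0)) := by
        rw [← setLIntegral_inv_Ioc hτ0pos hτ01]
        simp only [Real.rpow_neg_one]
      have hL : Real.log (1 / τ0) ≤ Real.log q := by
        rw [one_div, Real.log_inv, hτ0, Real.log_rpow hq0, neg_mul, neg_neg, one_div]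
        refine mul_le_of_le_one_left (Real.log_nonneg hq) (inv_le_one_of_one_le₀ ?_)
        exact_mod_cast hnpos
      have hk0 : (k : ℝ) ≠ 0 := by
        intro h0
        rw [h0] at h'
        linarith
      have hκ' : kappa n (k + 1) q = 1 + Real.log q := by
        have hnot : ¬ (((k + 1 : ℕ) : ℝ) < (n : ℝ) / 2 + 1) := by
          push_cast
          linarith
        have hn2 : (n : ℝ) = 2 * k := by linarith
        rw [kappa, if_neg hnot]
        push_cast
        simp only [add_sub_cancel_right]
        rw [hn2, div_self (by positivity), sub_self, zero_div, Real.rpow_one, Real.rpow_zero,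
          mul_one]
      rw [hinv, ← ENNReal.ofReal_add (by positivity)
        (Real.log_nonneg (by rw [le_div_iff₀ hτ0pos]; linarith))]
      refine ENNReal.ofReal_le_ofReal ?_
      have hlog := Real.log_nonneg hq
      rw [hκ']
      calc √c + Real.log (1 / τ0) ≤ (√c + 2) * 1 * (1 + Real.log q) := by nlinarith
        _ ≤ _ := by gcongr
    -- Again by integrality: `a ≥ 1` keeps the factor `2/a` from the integration below `2`,
    -- independently of `n` and `k`.
    · have ha1 : 1 ≤ a := by
        have : n < 2 * k := by
          have : (n : ℝ) < 2 * k := by linarith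
          exact_mod_cast this
        have : (n : ℝ) + 1 ≤ 2 * k := by exact_mod_cast this
        linarith
      rw [setLIntegral_rpow_Ioc hτ0pos.le hτ01 (Or.inr ⟨by linarith, hτ0pos⟩)]
      have hexp : τ0 ^ (-1 - a / 2 + 1) = q ^ (a / (2 * n)) := by
        rw [hτ0, ← Real.rpow_mul hq0.le]
        congr 1
        field_simp
        ring
      rw [hexp, Real.one_rpow]
      have hqa : 1 ≤ q ^ (a / (2 * n)) := Real.one_le_rpow hq (by positivity)
      have h3 : (1 - q ^ (a / (2 * n))) / (-1 - a / 2 + 1) ≤ 2 * q ^ (a / (2 * n)) := by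
        rw [div_le_iff_of_neg (by linarith)]
        nlinarith
      have hfin := rpow_le_exp_mul_kappa hk h hq
      calc _ ≤ ENNReal.ofReal (√c * q ^ (a / (2 * n))) +
            ENNReal.ofReal (2 * q ^ (a / (2 * n))) := by gcongr
        _ = ENNReal.ofReal ((√c + 2) * q ^ (a / (2 * n))) := by
            rw [← ENNReal.ofReal_add (by positivity) (by positivity)]
            congr 1
            ring
        _ ≤ _ := by
            refine ENNReal.ofReal_le_ofReal ?_
            rw [mul_assoc]
            gcongr

end

/-! ### The bound for the trilinear form integrated over all `t` -/

section

open scoped FourierTransform ENNReal LineDeriv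
open SchwartzMap

variable {n : ℕ}

/-- The constant in the bound for the trilinear form. -/
def pairingConst (n k : ℕ) (c : ℝ) : ℝ :=
  2 ^ (n + 2) * Real.pi ^ 2 + 2 ^ k * ((√c + 2) * Real.exp 1)

theorem pairingConst_pos (n k : ℕ) (c : ℝ) : 0 < pairingConst n k c := by
  unfold pairingConst
  positivity

/-- The part of the singular integral away from the diagonal. -/
theorem lintegral_pairing_Ioc_le {k : ℕ} (hk : k + 1 ≤ n) {η g φ : E n → ℝ} {Ω : Set (E n)}
    {M c q Q : ℝ} (hM : 0 ≤ M) (hc : 1 ≤ c) (hq : 1 ≤ q) (hQ0 : 0 ≤ Q) (hQ : Q ≤ c * q)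
    (hΩ : MeasurableSet Ω) (hη : ContDiff ℝ ∞ η) (hηc : HasCompactSupport η)
    {j : Fin n} (hψ1 : ∫⁻ x, ‖fderiv ℝ η x (e j)‖ₑ ≤ ENNReal.ofReal M)
    (hψΩ : ∀ x, ‖fderiv ℝ η x (e j)‖ₑ * volume Ω ≤ ENNReal.ofReal (M * Q))
    (hg : Integrable g) (hgΩ : ∀ y ∉ Ω, g y = 0)
    (hφ : ContDiff ℝ ∞ φ) (hφc : HasCompactSupport φ) :
    ∫⁻ t in Ioc (1 : ℝ) 2, ENNReal.ofReal ((t - 1) ^ (n - (k + 1)) * t ^ k / t) *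
        ‖pairing t η g (fun x => fderiv ℝ φ x (e j))‖ₑ ≤
      ENNReal.ofReal (2 ^ k * ((√c + 2) * Real.exp 1) * (M * kappa n (k + 1) q)) *
        (eLpNorm g 2 volume * eLpNorm φ 2 volume) := by
  have hη1 : Continuous fun x => fderiv ℝ η x (e j) :=
    (hη.continuous_fderiv (by simp)).clm_apply continuous_const
  have hκ := one_le_kappa n (k + 1) hq
  set N := eLpNorm g 2 volume * eLpNorm φ 2 volume
  set F : ℝ → ℝ≥0∞ := fun τ => ENNReal.ofReal (τ ^ (n - (k + 1)) * √(min (τ ^ n)⁻¹ Q)) with hF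
  have hFm : Measurable F := by
    simp only [hF]
    fun_prop
  calc ∫⁻ t in Ioc (1 : ℝ) 2, ENNReal.ofReal ((t - 1) ^ (n - (k + 1)) * t ^ k / t) *
        ‖pairing t η g (fun x => fderiv ℝ φ x (e j))‖ₑ
      ≤ ∫⁻ t in Ioc (1 : ℝ) 2, ENNReal.ofReal (2 ^ k * M) * N * F (t - 1) := by
        refine setLIntegral_mono' measurableSet_Ioc fun t ht => ?_
        have ht1 : 1 < t := ht.1
        have ht0 : 0 < t := by linarith
        have ht1' : 0 ≤ t - 1 := by linarith
        rw [pairing_fderiv t hη hηc hg hφ hφc j, enorm_neg, enorm_mul,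
          Real.enorm_of_nonneg ht0.le]
        have hp := enorm_pairing_le ht1 hΩ hM hQ0 hη1 hψ1 hψΩ hg.aestronglyMeasurable hgΩ
          hφ.continuous
        calc _ ≤ ENNReal.ofReal ((t - 1) ^ (n - (k + 1)) * t ^ k / t) * (ENNReal.ofReal t *
              (ENNReal.ofReal (M * √(min ((t - 1) ^ n)⁻¹ Q)) * N)) := by gcongr
          _ = ENNReal.ofReal ((t - 1) ^ (n - (k + 1)) * t ^ k *
              (M * √(min ((t - 1) ^ n)⁻¹ Q))) * N := by
              rw [← mul_assoc, ← mul_assoc, ← ENNReal.ofReal_mul (by positivity),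
                ← ENNReal.ofReal_mul (by positivity)]
              congr 2
              field_simp
          _ ≤ ENNReal.ofReal (2 ^ k * M * ((t - 1) ^ (n - (k + 1)) *
              √(min ((t - 1) ^ n)⁻¹ Q))) * N := by
              refine mul_le_mul_left (ENNReal.ofReal_le_ofReal ?_) _
              calc _ = t ^ k * M * ((t - 1) ^ (n - (k + 1)) * √(min ((t - 1) ^ n)⁻¹ Q)) := by
                    ring
                _ ≤ _ := by
                    have := ht.2
                    gcongr
          _ = _ := by
              rw [ENNReal.ofReal_mul (by positivity)]
              simp only [hF]
              ring
    _ = ENNReal.ofReal (2 ^ k * M) * N * ∫⁻ τ in Ioc (0 : ℝ) 1, F τ := by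
        rw [lintegral_const_mul _ (by fun_prop)]
        congr 1
        have := (measurePreserving_sub_right (volume : Measure ℝ) 1).setLIntegral_comp_preimage
          (s := Ioc 0 1) measurableSet_Ioc hFm
        rw [← this]
        congr 2
        ext t
        simp only [mem_preimage, mem_Ioc]
        constructor <;> rintro ⟨h1, h2⟩ <;> constructor <;> linarith
    _ ≤ ENNReal.ofReal (2 ^ k * M) * N *
        ENNReal.ofReal ((√c + 2) * Real.exp 1 * kappa n (k + 1) q) := by
        gcongr
        exact lintegral_min_le_kappa hk hc hq hQ
    _ = _ := by
        rw [mul_right_comm, ← ENNReal.ofReal_mul (by positivity)]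
        congr 2
        ring

theorem lintegral_pairing_le {k : ℕ} (hk : k + 1 ≤ n) {η g φ : E n → ℝ} {Ω : Set (E n)}
    {M ρ c q Q : ℝ} (hM : 0 ≤ M) (hρ : 0 < ρ) (hc : 1 ≤ c) (hq : 1 ≤ q) (hQ0 : 0 ≤ Q)
    (hQ : Q ≤ c * q) (hΩ : MeasurableSet Ω) (hη : ContDiff ℝ ∞ η) (hηc : HasCompactSupport η)
    (hdec : ∀ ξ, ‖𝓕 (fun x => (η x : ℂ)) ξ‖ ≤ M * ρ / (1 + ρ ^ 2 * ‖ξ‖ ^ 2))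
    {j : Fin n} (hψ1 : ∫⁻ x, ‖fderiv ℝ η x (e j)‖ₑ ≤ ENNReal.ofReal M)
    (hψΩ : ∀ x, ‖fderiv ℝ η x (e j)‖ₑ * volume Ω ≤ ENNReal.ofReal (M * Q))
    (hg : Integrable g) (hg2 : MemLp g 2) (hgΩ : ∀ y ∉ Ω, g y = 0)
    (hφ : ContDiff ℝ ∞ φ) (hφc : HasCompactSupport φ) :
    ∫⁻ t in Ioi (1 : ℝ), ENNReal.ofReal ((t - 1) ^ (n - (k + 1)) * t ^ k / t) *
        ‖pairing t η g (fun x => fderiv ℝ φ x (e j))‖ₑ ≤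
      ENNReal.ofReal (pairingConst n k c * (M * kappa n (k + 1) q)) *
        (eLpNorm g 2 volume * eLpNorm φ 2 volume) := by
  have hκ := one_le_kappa n (k + 1) hq
  rw [← Ioc_union_Ioi_eq_Ioi (one_le_two : (1 : ℝ) ≤ 2)]
  refine (lintegral_union_le _ _ _).trans ?_
  have near := lintegral_pairing_Ioc_le hk hM hc hq hQ0 hQ hΩ hη hηc hψ1 hψΩ hg hgΩ hφ hφc
  have far := lintegral_pairing_Ioi_two_le (A := M * ρ) (by positivity) hρ hη.continuous hηc hdec
    hg hg2 hφ hφc j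
  -- For `t > 2` the weight is at most `t^{n-2}`, and the earlier bound applies with `A = Mρ`. No
  -- `κ` is needed here; it is inserted through `κ ≥ 1` to match the other part.
  have far' : ∫⁻ t in Ioi (2 : ℝ), ENNReal.ofReal ((t - 1) ^ (n - (k + 1)) * t ^ k / t) *
        ‖pairing t η g (fun x => fderiv ℝ φ x (e j))‖ₑ ≤
      ENNReal.ofReal (2 ^ (n + 2) * Real.pi ^ 2 * (M * kappa n (k + 1) q)) *
        (eLpNorm g 2 volume * eLpNorm φ 2 volume) := by
    refine le_trans (setLIntegral_mono' measurableSet_Ioi fun t ht => ?_) (far.trans ?_)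
    · have ht : (2 : ℝ) < t := ht
      have ht0 : 0 < t := by linarith
      refine mul_le_mul_left (ENNReal.ofReal_le_ofReal ?_) _
      calc (t - 1) ^ (n - (k + 1)) * t ^ k / t ≤ t ^ (n - (k + 1)) * t ^ k / t := by
            have : 0 ≤ t - 1 := by linarith
            gcongr
            linarith
        _ = t ^ n / t ^ 2 := by
            have : t ^ n = t ^ (n - (k + 1)) * t ^ k * t := by
              rw [← pow_add, ← pow_succ]
              congr 1
              omega
            rw [this]
            field_simp
    · gcongr
      rw [mul_div_assoc, div_self hρ.ne', mul_one]
      exact le_mul_of_one_le_right hM hκ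
  refine (add_le_add near far').trans (le_of_eq ?_)
  rw [← add_mul, ← ENNReal.ofReal_add (by positivity) (by positivity), pairingConst]
  congr 2
  ring

/-- Decay of the Fourier transform from `L¹` bounds on the second derivatives. -/
theorem norm_fourier_le_of_integral_le {η : E n → ℝ} (hη : ContDiff ℝ ∞ η)
    (hηc : HasCompactSupport η) {B ρ : ℝ} (h0 : ∫ x, |η x| ≤ B)
    (h2 : ∀ j : Fin n,
      ρ ^ 2 * ∫ x, |fderiv ℝ (fun z => fderiv ℝ η z (e j)) x (e j)| ≤ B) (ξ : E n) :
    ‖𝓕 (fun x => (η x : ℂ)) ξ‖ ≤ (n + 1) * B / (1 + ρ ^ 2 * ‖ξ‖ ^ 2) := by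
  have hη' : ContDiff ℝ ∞ (fun x => (η x : ℂ)) := Complex.ofRealCLM.contDiff.comp hη
  have hηc' : HasCompactSupport (fun x => (η x : ℂ)) := hηc.comp_left (g := Complex.ofReal) rfl
  let H : 𝓢(E n, ℂ) := hηc'.toSchwartzMap hη'
  have hH : 𝓕 (fun x => (η x : ℂ)) = (𝓕 H : 𝓢(E n, ℂ)) := by
    rw [fourier_coe]
    rfl
  have hder : ∀ (f : E n → ℝ), ContDiff ℝ ∞ f → ∀ x v,
      fderiv ℝ (fun x => (f x : ℂ)) x v = ((fderiv ℝ f x v : ℝ) : ℂ) := by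
    intro f hf x v
    have h2 : fderiv ℝ (fun x => (f x : ℂ)) x = Complex.ofRealCLM.comp (fderiv ℝ f x) :=
      (Complex.ofRealCLM.hasFDerivAt.comp x (hf.differentiable (by simp) x).hasFDerivAt).fderiv
    rw [h2]
    rfl
  have hη1 : ∀ j : Fin n, ContDiff ℝ ∞ fun x => fderiv ℝ η x (e j) := fun j =>
    (hη.fderiv_right (m := ∞) (by simp)).clm_apply contDiff_const
  have hDD : ∀ (j : Fin n) x, (∂_{e j} (∂_{e j} H)) x =
      ((fderiv ℝ (fun z => fderiv ℝ η z (e j)) x (e j) : ℝ) : ℂ) := by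
    intro j x
    rw [← hder _ (hη1 j)]
    change fderiv ℝ (fun z => fderiv ℝ (fun x => (η x : ℂ)) z (e j)) x (e j) = _
    simp_rw [hder η hη]
  have hF0 : ‖(𝓕 H : 𝓢(E n, ℂ)) ξ‖ ≤ B := by
    rw [fourier_coe]
    refine (VectorFourier.norm_fourierIntegral_le_integral_norm _ _ _ _ _).trans ?_
    refine le_trans (le_of_eq ?_) h0
    refine integral_congr_ae (.of_forall fun x => ?_)
    exact Complex.norm_real _
  have hF2 : ∀ j : Fin n, ρ ^ 2 * (ξ j) ^ 2 * ‖(𝓕 H : 𝓢(E n, ℂ)) ξ‖ ≤ B := by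
    intro j
    have ht : (inner ℝ · (e j) : E n → ℝ).HasTemperateGrowth := by fun_prop
    have e1 : ‖(𝓕 (∂_{e j} (∂_{e j} H)) : 𝓢(E n, ℂ)) ξ‖ =
        (2 * Real.pi) ^ 2 * (ξ j) ^ 2 * ‖(𝓕 H : 𝓢(E n, ℂ)) ξ‖ := by
      rw [fourier_lineDerivOp_eq, fourier_lineDerivOp_eq]
      simp only [smul_apply, smulLeftCLM_apply_apply ht, norm_smul]
      have : inner ℝ ξ (e j) = ξ j := by
        rw [e, EuclideanSpace.inner_single_right]
        simp
      rw [this]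
      simp only [norm_mul, Complex.norm_real, Complex.norm_I, Real.norm_eq_abs,
        abs_of_pos Real.pi_pos, RCLike.norm_ofNat, mul_one]
      rw [← sq_abs (ξ j)]
      ring
    have e2 : ‖(𝓕 (∂_{e j} (∂_{e j} H)) : 𝓢(E n, ℂ)) ξ‖ ≤
        ∫ x, |fderiv ℝ (fun z => fderiv ℝ η z (e j)) x (e j)| := by
      rw [fourier_coe]
      refine (VectorFourier.norm_fourierIntegral_le_integral_norm _ _ _ _ _).trans ?_
      refine le_of_eq (integral_congr_ae (.of_forall fun x => ?_))
      simp only [hDD]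
      exact Complex.norm_real _
    have hpi : 1 ≤ (2 * Real.pi) ^ 2 := by
      have := Real.pi_gt_three
      nlinarith
    calc ρ ^ 2 * (ξ j) ^ 2 * ‖(𝓕 H : 𝓢(E n, ℂ)) ξ‖
        ≤ ρ ^ 2 * ((2 * Real.pi) ^ 2 * (ξ j) ^ 2 * ‖(𝓕 H : 𝓢(E n, ℂ)) ξ‖) := by
          rw [mul_assoc]
          gcongr
          exact le_mul_of_one_le_left (by positivity) hpi
      _ ≤ ρ ^ 2 * ∫ x, |fderiv ℝ (fun z => fderiv ℝ η z (e j)) x (e j)| := by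
          rw [← e1]
          gcongr
      _ ≤ B := h2 j
  rw [hH, le_div_iff₀ (by positivity)]
  -- The pure second derivatives suffice, since the `ξ_j²` add up to `‖ξ‖²`; they contribute `n` of
  -- the `n + 1` copies of `B`.
  calc ‖(𝓕 H : 𝓢(E n, ℂ)) ξ‖ * (1 + ρ ^ 2 * ‖ξ‖ ^ 2)
      = ‖(𝓕 H : 𝓢(E n, ℂ)) ξ‖ + ∑ j : Fin n, ρ ^ 2 * (ξ j) ^ 2 * ‖(𝓕 H : 𝓢(E n, ℂ)) ξ‖ := by
        rw [EuclideanSpace.real_norm_sq_eq, ← Finset.sum_mul, ← Finset.mul_sum]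
        ring
    _ ≤ B + ∑ j : Fin n, B := by
        gcongr with j
        exact hF2 j
    _ = (n + 1) * B := by
        simp
        ring

end

/-! ### Quantitative bounds for `θ` and for `θ` times a coordinate -/

section

open scoped FourierTransform ENNReal LineDeriv
open SchwartzMap

variable {n : ℕ}

/-- The bounds on a bump function that enter the estimate of `pairing`. -/
structure HasPairingBounds (η : E n → ℝ) (M ρ : ℝ) : Prop where
  nonneg : 0 ≤ M
  smooth : ContDiff ℝ ∞ η
  compact : HasCompactSupport η
  decay : ∀ ξ, ‖𝓕 (fun x => (η x : ℂ)) ξ‖ ≤ M * ρ / (1 + ρ ^ 2 * ‖ξ‖ ^ 2)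
  l1_fderiv : ∀ j, ∫⁻ x, ‖fderiv ℝ η x (e j)‖ₑ ≤ ENNReal.ofReal M
  sup_fderiv : ∀ j x, |fderiv ℝ η x (e j)| ≤ M / ρ ^ n

/-- A common bound for the constants `K_α` of order at most two that are used. -/
def weightConst (K : (k : ℕ) → (Fin k → Fin n) → ℝ) : ℝ :=
  (∑ J, |K 0 J|) + (∑ J, |K 1 J|) + ∑ J, |K 2 J|

theorem le_weightConst_zero (K : (k : ℕ) → (Fin k → Fin n) → ℝ) (J) : K 0 J ≤ weightConst K := by
  have h0 := (le_abs_self _).trans (Finset.single_le_sum (f := fun J => |K 0 J|)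
    (fun i _ => abs_nonneg _) (Finset.mem_univ J))
  have h1 : 0 ≤ ∑ J, |K 1 J| := Finset.sum_nonneg fun i _ => abs_nonneg _
  have h2 : 0 ≤ ∑ J, |K 2 J| := Finset.sum_nonneg fun i _ => abs_nonneg _
  unfold weightConst
  linarith

theorem le_weightConst_one (K : (k : ℕ) → (Fin k → Fin n) → ℝ) (J) : K 1 J ≤ weightConst K := by
  have h0 := (le_abs_self _).trans (Finset.single_le_sum (f := fun J => |K 1 J|)
    (fun i _ => abs_nonneg _) (Finset.mem_univ J))
  have h1 : 0 ≤ ∑ J, |K 0 J| := Finset.sum_nonneg fun i _ => abs_nonneg _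
  have h2 : 0 ≤ ∑ J, |K 2 J| := Finset.sum_nonneg fun i _ => abs_nonneg _
  unfold weightConst
  linarith

theorem le_weightConst_two (K : (k : ℕ) → (Fin k → Fin n) → ℝ) (J) : K 2 J ≤ weightConst K := by
  have h0 := (le_abs_self _).trans (Finset.single_le_sum (f := fun J => |K 2 J|)
    (fun i _ => abs_nonneg _) (Finset.mem_univ J))
  have h1 : 0 ≤ ∑ J, |K 0 J| := Finset.sum_nonneg fun i _ => abs_nonneg _
  have h2 : 0 ≤ ∑ J, |K 1 J| := Finset.sum_nonneg fun i _ => abs_nonneg _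
  unfold weightConst
  linarith

theorem weightConst_nonneg (K : (k : ℕ) → (Fin k → Fin n) → ℝ) : 0 ≤ weightConst K := by
  unfold weightConst
  positivity

theorem contDiff_fderiv_apply {η : E n → ℝ} (hη : ContDiff ℝ ∞ η) (v : E n) :
    ContDiff ℝ ∞ fun x => fderiv ℝ η x v :=
  (hη.fderiv_right (m := ∞) (by simp)).clm_apply contDiff_const

theorem partialDeriv_zero (J : Fin 0 → Fin n) (θ : E n → ℝ) (x : E n) :
    partialDeriv 0 J θ x = θ x := by
  simp [partialDeriv]

theorem partialDeriv_one (j : Fin n) (θ : E n → ℝ) (x : E n) :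
    partialDeriv 1 (fun _ => j) θ x = fderiv ℝ θ x (e j) := by
  simp [partialDeriv, iteratedFDeriv_one_apply]

theorem partialDeriv_two {θ : E n → ℝ} (hθ : ContDiff ℝ ∞ θ) (j : Fin n) (x : E n) :
    partialDeriv 2 (fun _ => j) θ x = fderiv ℝ (fun z => fderiv ℝ θ z (e j)) x (e j) := by
  rw [partialDeriv, iteratedFDeriv_two_apply]
  have h : DifferentiableAt ℝ (fderiv ℝ θ) x :=
    ((hθ.fderiv_right (m := ∞) (by simp)).differentiable (by simp)) x
  rw [fderiv_clm_apply h (differentiableAt_const _)]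
  simp

theorem diam_ball_eq (hn : 0 < n) (c : E n) {r : ℝ} (hr : 0 < r) :
    Metric.diam (Metric.ball c r) = 2 * r := by
  have : Nonempty (Fin n) := ⟨⟨0, hn⟩⟩
  exact Metric.diam_ball_eq c hr.le

variable {K : (k : ℕ) → (Fin k → Fin n) → ℝ} {c : E n} {r : ℝ} {θ : E n → ℝ}

theorem IsWeight.hasCompactSupport (hθ : IsWeight K c r θ) : HasCompactSupport θ :=
  HasCompactSupport.of_support_subset_isCompact (isCompact_closedBall c r)
    ((subset_tsupport θ).trans hθ.supp)

theorem lintegral_enorm_le_ofReal {f : E n → ℝ} (hf : Integrable f) {B : ℝ}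
    (h : ∫ x, |f x| ≤ B) : ∫⁻ x, ‖f x‖ₑ ≤ ENNReal.ofReal B := by
  rw [← ofReal_integral_norm_eq_lintegral_enorm hf]
  exact ENNReal.ofReal_le_ofReal h

/-- The constant here carries a factor `1/ρ`, with `ρ = 2r`, coming from the one derivative that
falls on `θ`. -/
theorem IsWeight.hasPairingBounds (hn : 0 < n) (hr : 0 < r) (hθ : IsWeight K c r θ) :
    HasPairingBounds θ ((n + 1) * weightConst K / (2 * r)) (2 * r) := by
  have hS := weightConst_nonneg K
  have hρ : 0 < 2 * r := by linarith
  have hn1 : (1 : ℝ) ≤ n + 1 := by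
    have : (0 : ℝ) ≤ n := by positivity
    linarith
  have hcd1 := fun j => (contDiff_fderiv_apply hθ.smooth (e j)).continuous
  refine ⟨by positivity, hθ.smooth, hθ.hasCompactSupport, fun ξ => ?_, fun j => ?_,
    fun j x => ?_⟩
  · have := norm_fourier_le_of_integral_le hθ.smooth hθ.hasCompactSupport (B := weightConst K)
      (ρ := 2 * r) ?_ (fun j => ?_) ξ
    · rwa [div_mul_cancel₀ _ hρ.ne']
    · have := hθ.l1_bound 0 Fin.elim0
      simp only [partialDeriv_zero, pow_zero, div_one] at this
      exact this.trans (le_weightConst_zero K _)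
    · have := hθ.l1_bound 2 (fun _ => j)
      simp only [partialDeriv_two hθ.smooth, diam_ball_eq hn c hr] at this
      calc _ ≤ (2 * r) ^ 2 * (K 2 (fun _ => j) / (2 * r) ^ 2) := by gcongr
        _ = K 2 (fun _ => j) := by field_simp
        _ ≤ _ := le_weightConst_two K _
  · refine lintegral_enorm_le_ofReal ((hcd1 j).integrable_of_hasCompactSupport
      (hθ.hasCompactSupport.fderiv_apply (𝕜 := ℝ) (e j))) ?_
    have := hθ.l1_bound 1 (fun _ => j)
    simp only [partialDeriv_one, diam_ball_eq hn c hr, pow_one] at this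
    refine this.trans ?_
    gcongr
    exact (le_weightConst_one K _).trans (le_mul_of_one_le_left hS hn1)
  · have := hθ.sup_bound 1 (fun _ => j) x
    simp only [partialDeriv_one, diam_ball_eq hn c hr] at this
    refine this.trans ?_
    rw [div_div, pow_succ']
    gcongr
    exact (le_weightConst_one K _).trans (le_mul_of_one_le_left hS hn1)

/-- The `i`-th coordinate centred at `c`. -/
def coord (c : E n) (i : Fin n) (z : E n) : ℝ := (z - c) i

theorem contDiff_coord (c : E n) (i : Fin n) : ContDiff ℝ ∞ (coord c i) := by
  unfold coord
  fun_prop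

theorem abs_coord_le (c : E n) (i : Fin n) (z : E n) : |coord c i z| ≤ ‖z - c‖ :=
  PiLp.norm_apply_le (z - c) i

theorem fderiv_coord (c : E n) (i j : Fin n) (z : E n) :
    fderiv ℝ (coord c i) z (e j) = if i = j then 1 else 0 := by
  have : HasFDerivAt (coord c i) (EuclideanSpace.proj i : E n →L[ℝ] ℝ) z := by
    have h := ((EuclideanSpace.proj i : E n →L[ℝ] ℝ).hasFDerivAt (x := z - c)).comp z
      ((hasFDerivAt_id z).sub_const c)
    simpa using! h
  rw [this.fderiv]
  simp [e]

theorem fderiv_coord_mul (c : E n) (i j : Fin n) {f : E n → ℝ} (hf : ContDiff ℝ ∞ f) (z : E n) :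
    fderiv ℝ (fun z => coord c i z * f z) z (e j) =
      (if i = j then 1 else 0) * f z + coord c i z * fderiv ℝ f z (e j) := by
  rw [fderiv_fun_mul ((contDiff_coord c i).differentiable (by simp) z)
    (hf.differentiable (by simp) z)]
  simp only [add_apply, smul_apply, smul_eq_mul, fderiv_coord]
  ring

theorem abs_coord_mul_le {f : E n → ℝ} (hf : tsupport f ⊆ Metric.closedBall c r) (hr : 0 < r)
    (i : Fin n) (z : E n) : |coord c i z * f z| ≤ 2 * r * |f z| := by
  by_cases hz : f z = 0
  · simp [hz]
  · have h1 := hf (subset_tsupport f hz)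
    rw [mem_closedBall_iff_norm] at h1
    rw [abs_mul]
    gcongr
    exact (abs_coord_le c i z).trans (by linarith)

theorem tsupport_fderiv_apply_subset' {f : E n → ℝ} (v : E n) :
    tsupport (fun x => fderiv ℝ f x v) ⊆ tsupport f := tsupport_fderiv_apply_subset ℝ v

/-- On the support of `θ` the coordinate centred at `c` is at most `r`, which compensates one
derivative: in contrast with `θ` itself, the constant contains no power of `ρ`. -/
theorem IsWeight.coord_mul_hasPairingBounds (hn : 0 < n) (hr : 0 < r) (hθ : IsWeight K c r θ)
    (i : Fin n) :
    HasPairingBounds (fun z => coord c i z * θ z) ((n + 1) * (3 * weightConst K)) (2 * r) := by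
  have hS := weightConst_nonneg K
  have hρ : 0 < 2 * r := by linarith
  have hn1 : (1 : ℝ) ≤ n + 1 := by
    have : (0 : ℝ) ≤ n := by positivity
    linarith
  have hcs := hθ.hasCompactSupport
  have hcd1 := fun j => contDiff_fderiv_apply hθ.smooth (e j)
  have hcd2 := fun j => contDiff_fderiv_apply (hcd1 j) (e j)
  have hcs1 : ∀ j : Fin n, HasCompactSupport fun x => fderiv ℝ θ x (e j) :=
    fun j => hcs.fderiv_apply (𝕜 := ℝ) (e j)
  have hcs2 : ∀ j : Fin n, HasCompactSupport
    fun x => fderiv ℝ (fun z => fderiv ℝ θ z (e j)) x (e j) :=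
    fun j => (hcs1 j).fderiv_apply (𝕜 := ℝ) (e j)
  have hsm : ContDiff ℝ ∞ fun z => coord c i z * θ z := (contDiff_coord c i).mul hθ.smooth
  have hsc : HasCompactSupport fun z => coord c i z * θ z := hcs.mul_left
  have i0 : Integrable θ := hθ.smooth.continuous.integrable_of_hasCompactSupport hcs
  have i1 : ∀ j : Fin n, Integrable fun x => fderiv ℝ θ x (e j) := fun j =>
    (hcd1 j).continuous.integrable_of_hasCompactSupport (hcs1 j)
  have i2 : ∀ j : Fin n, Integrable fun x => fderiv ℝ (fun z => fderiv ℝ θ z (e j)) x (e j) :=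
    fun j => (hcd2 j).continuous.integrable_of_hasCompactSupport (hcs2 j)
  have a0 : ∫ x, |θ x| ≤ weightConst K := by
    have := hθ.l1_bound 0 Fin.elim0
    simp only [partialDeriv_zero, pow_zero, div_one] at this
    exact this.trans (le_weightConst_zero K _)
  have a1 : ∀ j : Fin n, ∫ x, |fderiv ℝ θ x (e j)| ≤ weightConst K / (2 * r) := by
    intro j
    have := hθ.l1_bound 1 (fun _ => j)
    simp only [partialDeriv_one, diam_ball_eq hn c hr, pow_one] at this
    refine this.trans ?_
    gcongr
    exact le_weightConst_one K _
  have a2 : ∀ j : Fin n, ∫ x, |fderiv ℝ (fun z => fderiv ℝ θ z (e j)) x (e j)| ≤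
      weightConst K / (2 * r) ^ 2 := by
    intro j
    have := hθ.l1_bound 2 (fun _ => j)
    simp only [partialDeriv_two hθ.smooth, diam_ball_eq hn c hr] at this
    refine this.trans ?_
    gcongr
    exact le_weightConst_two K _
  have b0 : ∀ x, |θ x| ≤ weightConst K / (2 * r) ^ n := by
    intro x
    have := hθ.sup_bound 0 Fin.elim0 x
    simp only [partialDeriv_zero, diam_ball_eq hn c hr, add_zero] at this
    refine this.trans ?_
    gcongr
    exact le_weightConst_zero K _
  have b1 : ∀ j x, |fderiv ℝ θ x (e j)| ≤ weightConst K / (2 * r) ^ (n + 1) := by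
    intro j x
    have := hθ.sup_bound 1 (fun _ => j) x
    simp only [partialDeriv_one, diam_ball_eq hn c hr] at this
    refine this.trans ?_
    gcongr
    exact le_weightConst_one K _
  have hite : ∀ (j : Fin n) (x : ℝ), |(if i = j then 1 else 0) * x| ≤ |x| := by
    intro j x
    split_ifs <;> simp
  have d1 : ∀ j z, |fderiv ℝ (fun z => coord c i z * θ z) z (e j)| ≤
      |θ z| + 2 * r * |fderiv ℝ θ z (e j)| := by
    intro j z
    rw [fderiv_coord_mul c i j hθ.smooth]
    refine (abs_add_le _ _).trans (add_le_add (hite j _) ?_)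
    exact abs_coord_mul_le ((tsupport_fderiv_apply_subset' _).trans hθ.supp) hr i z
  -- The coordinate is affine, so the product rule leaves two cross terms and one term with all
  -- derivatives on `θ`. After integration these give `2 + 1`, the `3` in the constant.
  have d2 : ∀ j z, |fderiv ℝ (fun z => fderiv ℝ (fun z => coord c i z * θ z) z (e j)) z (e j)| ≤
      2 * |fderiv ℝ θ z (e j)| + 2 * r * |fderiv ℝ (fun z => fderiv ℝ θ z (e j)) z (e j)| := by
    intro j z
    have e1 : (fun z => fderiv ℝ (fun z => coord c i z * θ z) z (e j)) =
        fun z => (if i = j then 1 else 0) * θ z + coord c i z * fderiv ℝ θ z (e j) :=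
      funext fun z => fderiv_coord_mul c i j hθ.smooth z
    rw [e1, fderiv_fun_add ((hθ.smooth.differentiable (by simp) z).const_mul _)
      (((contDiff_coord c i).mul (hcd1 j)).differentiable (by simp) z),
      fderiv_const_mul (hθ.smooth.differentiable (by simp) z)]
    simp only [add_apply, smul_apply, smul_eq_mul, fderiv_coord_mul c i j (hcd1 j)]
    have h3 := abs_coord_mul_le (f := fun z => fderiv ℝ (fun z => fderiv ℝ θ z (e j)) z (e j))
      (((tsupport_fderiv_apply_subset' _).trans (tsupport_fderiv_apply_subset' _)).trans hθ.supp)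
      hr i z
    have h4 := hite j (fderiv ℝ θ z (e j))
    refine (abs_add_le _ _).trans ((add_le_add le_rfl (abs_add_le _ _)).trans ?_)
    linarith
  refine ⟨by positivity, hsm, hsc, fun ξ => ?_, fun j => ?_, fun j x => ?_⟩
  · have := norm_fourier_le_of_integral_le hsm hsc (B := 3 * weightConst K * (2 * r))
      (ρ := 2 * r) ?_ (fun j => ?_) ξ
    · rwa [← mul_assoc] at this
    · calc ∫ x, |coord c i x * θ x| ≤ ∫ x, 2 * r * |θ x| :=
            integral_mono (hsm.continuous.integrable_of_hasCompactSupport hsc).abs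
              (i0.abs.const_mul _) fun x => abs_coord_mul_le hθ.supp hr i x
        _ = 2 * r * ∫ x, |θ x| := integral_const_mul _ _
        _ ≤ 2 * r * (3 * weightConst K) := by
            gcongr
            linarith
        _ = _ := by ring
    · have hD := contDiff_fderiv_apply (contDiff_fderiv_apply hsm (e j)) (e j)
      have hDc := (hsc.fderiv_apply (𝕜 := ℝ) (e j)).fderiv_apply (𝕜 := ℝ) (e j)
      calc _ ≤ (2 * r) ^ 2 * ∫ z, (2 * |fderiv ℝ θ z (e j)| +
            2 * r * |fderiv ℝ (fun z => fderiv ℝ θ z (e j)) z (e j)|) := by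
            refine mul_le_mul_of_nonneg_left ?_ (by positivity)
            exact integral_mono (hD.continuous.integrable_of_hasCompactSupport hDc).abs
              (((i1 j).abs.const_mul _).add ((i2 j).abs.const_mul _)) (d2 j)
        _ = (2 * r) ^ 2 * (2 * (∫ z, |fderiv ℝ θ z (e j)|) +
            2 * r * ∫ z, |fderiv ℝ (fun z => fderiv ℝ θ z (e j)) z (e j)|) := by
            rw [integral_add ((i1 j).abs.const_mul _) ((i2 j).abs.const_mul _),
              integral_const_mul, integral_const_mul]
        _ ≤ (2 * r) ^ 2 * (2 * (weightConst K / (2 * r)) +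
            2 * r * (weightConst K / (2 * r) ^ 2)) := by
            gcongr
            · exact a1 j
            · exact a2 j
        _ = _ := by
            field_simp
            ring
  · have hD := contDiff_fderiv_apply hsm (e j)
    have hDi : Integrable fun x => fderiv ℝ (fun z => coord c i z * θ z) x (e j) :=
      hD.continuous.integrable_of_hasCompactSupport (hsc.fderiv_apply (𝕜 := ℝ) (e j))
    refine lintegral_enorm_le_ofReal hDi ?_
    calc _ ≤ ∫ z, (|θ z| + 2 * r * |fderiv ℝ θ z (e j)|) :=
          integral_mono hDi.abs (i0.abs.add ((i1 j).abs.const_mul _)) (d1 j)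
      _ = (∫ z, |θ z|) + 2 * r * ∫ z, |fderiv ℝ θ z (e j)| := by
          rw [integral_add i0.abs ((i1 j).abs.const_mul _), integral_const_mul]
      _ ≤ weightConst K + 2 * r * (weightConst K / (2 * r)) := by
          gcongr
          exact a1 j
      _ = 1 * (2 * weightConst K) := by
          field_simp
          ring
      _ ≤ _ := by
          gcongr
          norm_num
  · calc _ ≤ |θ x| + 2 * r * |fderiv ℝ θ x (e j)| := d1 j x
      _ ≤ weightConst K / (2 * r) ^ n + 2 * r * (weightConst K / (2 * r) ^ (n + 1)) := by
          gcongr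
          · exact b0 x
          · exact b1 j x
      _ = 1 * (2 * weightConst K) / (2 * r) ^ n := by
          rw [pow_succ]
          field_simp
          ring
      _ ≤ _ := by
          gcongr
          norm_num

end

/-! ### An integrable convolution majorant of the kernel -/

section

open scoped ENNReal

variable {n : ℕ}

/-- An integrable radial majorant of the kernel. -/
def envelope (D : ℝ) (v : E n) : ℝ≥0∞ :=
  ∫⁻ t in Ioi (1 : ℝ), ENNReal.ofReal (t ^ (n - 1) * (D / t)) *
    (Metric.closedBall (0 : E n) (D / t)).indicator 1 v

theorem measurable_envelope_integrand (D : ℝ) : Measurable fun p : E n × ℝ =>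
    ENNReal.ofReal (p.2 ^ (n - 1) * (D / p.2)) *
      (Metric.closedBall (0 : E n) (D / p.2)).indicator (1 : E n → ℝ≥0∞) p.1 := by
  refine Measurable.mul (by fun_prop) ?_
  have hs : MeasurableSet {p : E n × ℝ | ‖p.1‖ ≤ D / p.2} :=
    measurableSet_le (by fun_prop) (by fun_prop)
  have h : (fun p : E n × ℝ => (Metric.closedBall (0 : E n) (D / p.2)).indicator
      (1 : E n → ℝ≥0∞) p.1) = {p : E n × ℝ | ‖p.1‖ ≤ D / p.2}.indicator 1 := by
    funext p
    simp only [indicator, mem_closedBall_zero_iff, mem_ofPred_eq, Pi.one_apply]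
  rw [h]
  exact measurable_one.indicator hs

theorem measurable_envelope (D : ℝ) : Measurable (envelope D : E n → ℝ≥0∞) :=
  (measurable_envelope_integrand D).lintegral_prod_right'

/-- By Tonelli, each `t` contributes `t^{n-1} · (D/t) · (D/t)^n = D^{n+1} t^{-2}` times the volume
of the unit ball, and `t^{-2}` is integrable on `(1, ∞)`. -/
theorem lintegral_envelope_lt_top (hn : 0 < n) {D : ℝ} (hD : 0 ≤ D) :
    ∫⁻ v : E n, envelope D v < ⊤ := by
  unfold envelope
  rw [lintegral_lintegral_swap (measurable_envelope_integrand D).aemeasurable]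
  have hvol : volume (Metric.closedBall (0 : E n) 1) < ⊤ := measure_closedBall_lt_top
  calc ∫⁻ t in Ioi (1 : ℝ), ∫⁻ v : E n, ENNReal.ofReal (t ^ (n - 1) * (D / t)) *
        (Metric.closedBall (0 : E n) (D / t)).indicator 1 v
      = ∫⁻ t in Ioi (1 : ℝ), ENNReal.ofReal (t ^ (-2 : ℝ)) * (ENNReal.ofReal (D ^ (n + 1)) *
          volume (Metric.closedBall (0 : E n) 1)) := by
        refine setLIntegral_congr_fun measurableSet_Ioi fun t ht => ?_
        have ht1 : (1 : ℝ) < t := ht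
        have ht0 : 0 < t := by linarith
        rw [lintegral_const_mul' _ _ ENNReal.ofReal_ne_top,
          lintegral_indicator_one Metric.isClosed_closedBall.measurableSet,
          Measure.addHaar_closedBall' volume _ (by positivity), finrank_euclideanSpace_fin,
          ← mul_assoc, ← mul_assoc, ← ENNReal.ofReal_mul (by positivity),
          ← ENNReal.ofReal_mul (by positivity)]
        congr 2
        rw [Real.rpow_neg ht0.le]
        obtain ⟨m, rfl⟩ : ∃ m, n = m + 1 := ⟨n - 1, by omega⟩
        simp only [Nat.add_sub_cancel]
        norm_num
        rw [div_pow]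
        field_simp
        ring
    _ < ⊤ := by
        rw [lintegral_mul_const _ (by fun_prop)]
        refine ENNReal.mul_lt_top ?_ (ENNReal.mul_lt_top ENNReal.ofReal_lt_top hvol)
        exact ((integrableOn_Ioi_rpow_of_lt (by norm_num : (-2 : ℝ) < -1)
          one_pos).lintegral_lt_top)

/-- Young's inequality for convolution with an integrable kernel. -/
theorem lintegral_conv_sq_le {κ f : E n → ℝ≥0∞} (hκ : Measurable κ) (hf : AEMeasurable f) :
    ∫⁻ x, (∫⁻ y, κ (x - y) * f y) ^ 2 ≤ (∫⁻ v, κ v) ^ 2 * ∫⁻ y, f y ^ 2 := by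
  have hm : AEMeasurable (fun p : E n × E n => κ (p.1 - p.2) * f p.2 ^ 2) := by
    refine (hκ.comp (by fun_prop)).aemeasurable.mul (AEMeasurable.pow_const ?_ 2)
    exact hf.comp_snd
  calc ∫⁻ x, (∫⁻ y, κ (x - y) * f y) ^ 2
      ≤ ∫⁻ x, (∫⁻ v, κ v) * ∫⁻ y, κ (x - y) * f y ^ 2 := by
        refine lintegral_mono fun x => ?_
        have := lintegral_mul_mul_sq_le (μ := (volume : Measure (E n)))
          (k := fun y => κ (x - y)) (f := f) (g := 1)
          (hκ.comp (by fun_prop)).aemeasurable hf aemeasurable_const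
        simp only [Pi.one_apply, mul_one, one_pow] at this
        rw [lintegral_sub_left_eq_self κ x, mul_comm] at this
        exact this
    _ ≤ (∫⁻ v, κ v) * ∫⁻ x, ∫⁻ y, κ (x - y) * f y ^ 2 := by
        rw [lintegral_const_mul'' _ hm.lintegral_prod_right']
    _ = (∫⁻ v, κ v) * ∫⁻ y, (∫⁻ v, κ v) * f y ^ 2 := by
        rw [lintegral_lintegral_swap hm]
        congr 2
        funext y
        have hmy : Measurable fun x => κ (x - y) := hκ.comp (by fun_prop)
        rw [lintegral_mul_const _ hmy, lintegral_sub_right_eq_self κ y]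
    _ = _ := by
        rw [lintegral_const_mul'' _ (hf.pow_const 2)]
        ring

variable {K : (k : ℕ) → (Fin k → Fin n) → ℝ} {c : E n} {r : ℝ} {θ : E n → ℝ}

/-- The weight `(t-1)^{n-k-1} t^k` in the kernel. -/
def tweight (n k : ℕ) (t : ℝ) : ℝ := (t - 1) ^ (n - (k + 1)) * t ^ k

theorem tweight_nonneg (n k : ℕ) {t : ℝ} (ht : 1 < t) : 0 ≤ tweight n k t := by
  have : 0 ≤ t - 1 := by linarith
  unfold tweight
  positivity

theorem tweight_le {k : ℕ} (hk : k + 1 ≤ n) {t : ℝ} (ht : 1 < t) :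
    tweight n k t ≤ t ^ (n - 1) := by
  have : 0 ≤ t - 1 := by linarith
  calc tweight n k t ≤ t ^ (n - (k + 1)) * t ^ k := by
        unfold tweight
        gcongr
        linarith
    _ = _ := by
        rw [← pow_add]
        congr 1
        omega

/-- If `θ` does not vanish at `y + t(x-y)`, that point is within `r` of `c`, and `y` is within `R`;
hence `t‖x - y‖ ≤ R + r`. -/
theorem lintegral_kernel_le_envelope {k : ℕ} (hk : k + 1 ≤ n) {S R : ℝ}
    (hsupp : tsupport θ ⊆ Metric.closedBall c r) (hS : ∀ z, |θ z| ≤ S)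
    (x : E n) {y : E n} (hy : ‖y - c‖ ≤ R) :
    ∫⁻ t in Ioi (1 : ℝ), ‖tweight n k t * θ (y + t • (x - y))‖ₑ * ‖x - y‖ₑ ≤
      ENNReal.ofReal S * envelope (R + r) (x - y) := by
  have hS0 : 0 ≤ S := (abs_nonneg _).trans (hS 0)
  unfold envelope
  rw [← lintegral_const_mul' _ _ ENNReal.ofReal_ne_top]
  refine setLIntegral_mono' measurableSet_Ioi fun t ht => ?_
  have ht1 : (1 : ℝ) < t := ht
  have ht0 : 0 < t := by linarith
  by_cases hz : θ (y + t • (x - y)) = 0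
  · simp [hz]
  have h1 := hsupp (subset_tsupport θ hz)
  rw [mem_closedBall_iff_norm] at h1
  have h2 : ‖x - y‖ ≤ (R + r) / t := by
    rw [le_div_iff₀ ht0, mul_comm]
    calc t * ‖x - y‖ = ‖(y + t • (x - y) - c) - (y - c)‖ := by
          rw [show (y + t • (x - y) - c) - (y - c) = t • (x - y) by abel, norm_smul,
            Real.norm_of_nonneg ht0.le]
      _ ≤ _ := (norm_sub_le _ _).trans (by linarith)
  rw [indicator_of_mem (mem_closedBall_zero_iff.2 h2), Pi.one_apply, mul_one,
    ← ofReal_norm, ← ofReal_norm, ← ENNReal.ofReal_mul (by positivity),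
    ← ENNReal.ofReal_mul hS0]
  refine ENNReal.ofReal_le_ofReal ?_
  rw [norm_mul, Real.norm_of_nonneg (tweight_nonneg n k ht1), Real.norm_eq_abs]
  calc tweight n k t * |θ (y + t • (x - y))| * ‖x - y‖
      ≤ t ^ (n - 1) * S * ((R + r) / t) := by
        gcongr
        · exact tweight_le hk ht1
        · exact hS _
    _ = _ := by ring

theorem kernelG_eq (k : ℕ) (θ : E n → ℝ) (x y : E n) :
    kernelG (k + 1) θ x y = ∫ t in Ioi (1 : ℝ), tweight n k t * θ (y + t • (x - y)) := rfl

theorem stronglyMeasurable_kernelG (k : ℕ) (hθ : Continuous θ) :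
    StronglyMeasurable fun p : E n × E n => kernelG (k + 1) θ p.1 p.2 := by
  have : Continuous fun q : (E n × E n) × ℝ =>
      tweight n k q.2 * θ (q.1.2 + q.2 • (q.1.1 - q.1.2)) := by
    unfold tweight
    fun_prop
  exact this.stronglyMeasurable.integral_prod_right'

theorem enorm_kernelG_mul_le {k : ℕ} (hk : k + 1 ≤ n) {S R : ℝ}
    (hsupp : tsupport θ ⊆ Metric.closedBall c r) (hS : ∀ z, |θ z| ≤ S)
    (x : E n) {y : E n} (hy : ‖y - c‖ ≤ R) (i : Fin n) :
    ‖kernelG (k + 1) θ x y * (x - y) i‖ₑ ≤ ENNReal.ofReal S * envelope (R + r) (x - y) := by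
  refine le_trans ?_ (lintegral_kernel_le_envelope hk hsupp hS x hy)
  rw [lintegral_mul_const' _ _ enorm_ne_top, enorm_mul]
  gcongr
  · exact enorm_integral_le_lintegral_enorm _
  · rw [← ofReal_norm, ← ofReal_norm]
    exact ENNReal.ofReal_le_ofReal (PiLp.norm_apply_le (x - y) i)

end

/-! ### The scalar operator: convergence, `L²` membership and Fubini -/

section

open scoped ENNReal

variable {n : ℕ} {c : E n} {r R S : ℝ} {θ g D : E n → ℝ} {k : ℕ}

/-- A scalar component of the Bogovskii-type operator. -/
def bogScalar (k : ℕ) (θ : E n → ℝ) (i : Fin n) (g : E n → ℝ) (x : E n) : ℝ :=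
  ∫ y, kernelG (k + 1) θ x y * (x - y) i * g y

/-- The assumptions on the bump function and on the density in the scalar operator. -/
structure ScalarData (c : E n) (r R S : ℝ) (θ g : E n → ℝ) : Prop where
  r_pos : 0 < r
  R_nonneg : 0 ≤ R
  cont : Continuous θ
  supp : tsupport θ ⊆ Metric.closedBall c r
  bound : ∀ z, |θ z| ≤ S
  memLp : MemLp g 2
  g_supp : ∀ y, g y ≠ 0 → ‖y - c‖ ≤ R

/-- The convolution kernel dominating the scalar operator. -/
def domKernel (r R S : ℝ) (v : E n) : ℝ≥0∞ := ENNReal.ofReal S * envelope (R + r) v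

theorem measurable_domKernel : Measurable (domKernel r R S : E n → ℝ≥0∞) :=
  (measurable_envelope _).const_mul _

namespace ScalarData

theorem lintegral_domKernel_lt_top (h : ScalarData c r R S θ g) (hn : 0 < n) :
    ∫⁻ v : E n, domKernel r R S v < ⊤ := by
  unfold domKernel
  rw [lintegral_const_mul' _ _ ENNReal.ofReal_ne_top]
  exact ENNReal.mul_lt_top ENNReal.ofReal_lt_top
    (lintegral_envelope_lt_top hn (add_nonneg h.R_nonneg h.r_pos.le))

theorem hasCompactSupport (h : ScalarData c r R S θ g) : HasCompactSupport θ :=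
  HasCompactSupport.of_support_subset_isCompact (isCompact_closedBall c r)
    ((subset_tsupport θ).trans h.supp)

theorem integrable (h : ScalarData c r R S θ g) : Integrable g := by
  have : IsFiniteMeasure (volume.restrict (Metric.closedBall c R)) :=
    isFiniteMeasure_restrict.2 measure_closedBall_lt_top.ne
  have h1 : IntegrableOn g (Metric.closedBall c R) :=
    (h.memLp.restrict _).integrable (by norm_num)
  refine (integrableOn_iff_integrable_of_support_subset fun y hy => ?_).1 h1
  rw [mem_closedBall_iff_norm]
  exact h.g_supp y hy

theorem enorm_integrand_le (h : ScalarData c r R S θ g) (hk : k + 1 ≤ n) (i : Fin n) (x y : E n) :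
    ‖kernelG (k + 1) θ x y * (x - y) i * g y‖ₑ ≤ domKernel r R S (x - y) * ‖g y‖ₑ := by
  by_cases hy : g y = 0
  · simp [hy]
  · rw [enorm_mul]
    gcongr
    exact enorm_kernelG_mul_le hk h.supp h.bound x (h.g_supp y hy) i

theorem lintegral_dom_sq_lt_top (h : ScalarData c r R S θ g) (hn : 0 < n) :
    ∫⁻ x, (∫⁻ y, domKernel r R S (x - y) * ‖g y‖ₑ) ^ 2 < ⊤ := by
  refine (lintegral_conv_sq_le measurable_domKernel h.memLp.1.enorm).trans_lt ?_
  rw [← eLpNorm_two_sq]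
  exact ENNReal.mul_lt_top (ENNReal.pow_lt_top (h.lintegral_domKernel_lt_top hn))
    (ENNReal.pow_lt_top h.memLp.2)

theorem aemeasurable_dom (h : ScalarData c r R S θ g) :
    AEMeasurable fun p : E n × E n => domKernel r R S (p.1 - p.2) * ‖g p.2‖ₑ :=
  (measurable_domKernel.comp (by fun_prop)).aemeasurable.mul h.memLp.1.enorm.comp_snd

theorem aestronglyMeasurable_integrand (h : ScalarData c r R S θ g) (i : Fin n) :
    AEStronglyMeasurable fun p : E n × E n =>
      kernelG (k + 1) θ p.1 p.2 * (p.1 - p.2) i * g p.2 := by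
  refine AEStronglyMeasurable.mul ?_ h.memLp.1.comp_snd
  refine (stronglyMeasurable_kernelG k h.cont).aestronglyMeasurable.mul ?_
  exact Continuous.aestronglyMeasurable (by fun_prop)

/-- The dominating convolution is square integrable by Young's inequality, hence finite almost
everywhere. -/
theorem ae_integrable (h : ScalarData c r R S θ g) (hk : k + 1 ≤ n) (i : Fin n) :
    ∀ᵐ x, Integrable fun y => kernelG (k + 1) θ x y * (x - y) i * g y := by
  have h1 : ∀ᵐ x : E n, (∫⁻ y, domKernel r R S (x - y) * ‖g y‖ₑ) ^ 2 < ⊤ :=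
    ae_lt_top' (h.aemeasurable_dom.lintegral_prod_right'.pow_const 2)
      (h.lintegral_dom_sq_lt_top (by omega)).ne
  filter_upwards [h1] with x hx
  refine ⟨?_, ?_⟩
  · refine AEStronglyMeasurable.mul ?_ h.memLp.1
    refine ((stronglyMeasurable_kernelG k h.cont).comp_measurable
      measurable_prodMk_left).aestronglyMeasurable.mul ?_
    exact Continuous.aestronglyMeasurable (by fun_prop)
  · refine (lintegral_mono fun y => h.enorm_integrand_le hk i x y).trans_lt ?_
    by_contra hc
    rw [not_lt, top_le_iff] at hc
    rw [hc] at hx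
    simp at hx

theorem memLp_bogScalar (h : ScalarData c r R S θ g) (hk : k + 1 ≤ n) (i : Fin n) :
    MemLp (bogScalar k θ i g) 2 := by
  refine ⟨(h.aestronglyMeasurable_integrand i).integral_prod_right', ?_⟩
  have : eLpNorm (bogScalar k θ i g) 2 volume ^ 2 < ⊤ := by
    rw [eLpNorm_two_sq]
    refine lt_of_le_of_lt (lintegral_mono fun x => ?_) (h.lintegral_dom_sq_lt_top (by omega))
    gcongr
    exact (enorm_integral_le_lintegral_enorm _).trans
      (lintegral_mono fun y => h.enorm_integrand_le hk i x y)
  by_contra hc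
  rw [not_lt, top_le_iff] at hc
  rw [hc] at this
  simp at this

/-- This licenses the exchange of the `t`-integral with the integrals over `x` and `y`. The `(x -
y)_i` factor must stay inside: it is what the envelope uses to gain integrability in `t`. -/
theorem integrable_triple (h : ScalarData c r R S θ g) (hk : k + 1 ≤ n) (i : Fin n)
    (hD : MemLp D 2) :
    Integrable (fun q : (E n × E n) × ℝ =>
      tweight n k q.2 * θ (q.1.2 + q.2 • (q.1.1 - q.1.2)) *
        ((q.1.1 - q.1.2) i * (D q.1.1 * g q.1.2)))
      ((volume : Measure (E n × E n)).prod (volume.restrict (Ioi (1 : ℝ)))) := by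
  have hDg : AEStronglyMeasurable fun p : E n × E n => D p.1 * g p.2 :=
    hD.1.comp_fst.mul h.memLp.1.comp_snd
  have hm : AEStronglyMeasurable (fun q : (E n × E n) × ℝ =>
      tweight n k q.2 * θ (q.1.2 + q.2 • (q.1.1 - q.1.2)) *
        ((q.1.1 - q.1.2) i * (D q.1.1 * g q.1.2)))
      ((volume : Measure (E n × E n)).prod (volume.restrict (Ioi (1 : ℝ)))) := by
    refine AEStronglyMeasurable.mul (Continuous.aestronglyMeasurable ?_)
      (AEStronglyMeasurable.mul (Continuous.aestronglyMeasurable (by fun_prop)) hDg.comp_fst)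
    have := h.cont
    unfold tweight
    fun_prop
  refine ⟨hm, ?_⟩
  rw [HasFiniteIntegral, lintegral_prod _ hm.enorm]
  have hpt : ∀ p : E n × E n, ∫⁻ t in Ioi (1 : ℝ),
      ‖tweight n k t * θ (p.2 + t • (p.1 - p.2)) * ((p.1 - p.2) i * (D p.1 * g p.2))‖ₑ ≤
      ‖D p.1‖ₑ * (domKernel r R S (p.1 - p.2) * ‖g p.2‖ₑ) := by
    intro p
    by_cases hy : g p.2 = 0
    · simp [hy]
    have h1 := lintegral_kernel_le_envelope hk h.supp h.bound p.1 (h.g_supp _ hy)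
    calc _ ≤ ∫⁻ t in Ioi (1 : ℝ), ‖tweight n k t * θ (p.2 + t • (p.1 - p.2))‖ₑ *
          ‖p.1 - p.2‖ₑ * (‖D p.1‖ₑ * ‖g p.2‖ₑ) := by
          refine lintegral_mono fun t => ?_
          rw [enorm_mul, enorm_mul ((p.1 - p.2) i), enorm_mul (D p.1), ← mul_assoc]
          gcongr
          rw [← ofReal_norm, ← ofReal_norm]
          exact ENNReal.ofReal_le_ofReal (PiLp.norm_apply_le (p.1 - p.2) i)
      _ ≤ (ENNReal.ofReal S * envelope (R + r) (p.1 - p.2)) * (‖D p.1‖ₑ * ‖g p.2‖ₑ) := by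
          rw [lintegral_mul_const' _ _ (ENNReal.mul_ne_top enorm_ne_top enorm_ne_top)]
          gcongr
      _ = _ := by
          rw [domKernel]
          ring
  refine (lintegral_mono hpt).trans_lt ?_
  rw [Measure.volume_eq_prod, lintegral_prod _ (by
    exact hD.1.enorm.comp_fst.mul h.aemeasurable_dom)]
  -- The elementary `ab ≤ a² + b²`, obtained by comparing `a` with `b`.
  have hin : ∀ x, ∫⁻ y, ‖D x‖ₑ * (domKernel r R S (x - y) * ‖g y‖ₑ) ≤
      ‖D x‖ₑ ^ 2 + (∫⁻ y, domKernel r R S (x - y) * ‖g y‖ₑ) ^ 2 := by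
    intro x
    rw [lintegral_const_mul' _ _ enorm_ne_top]
    rcases le_total ‖D x‖ₑ (∫⁻ y, domKernel r R S (x - y) * ‖g y‖ₑ) with hle | hle
    · refine le_add_left ?_
      rw [sq]
      gcongr
    · refine le_add_right ?_
      rw [sq]
      gcongr
  refine (lintegral_mono hin).trans_lt ?_
  rw [lintegral_add_left' (hD.1.enorm.pow_const 2), ← eLpNorm_two_sq]
  exact ENNReal.add_lt_top.2 ⟨ENNReal.pow_lt_top hD.2, h.lintegral_dom_sq_lt_top (by omega)⟩

theorem integrable_coord_mul (h : ScalarData c r R S θ g) (i : Fin n) :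
    Integrable fun y => coord c i y * g y := by
  refine (h.integrable.norm.const_mul R).mono'
    ((contDiff_coord c i).continuous.aestronglyMeasurable.mul h.memLp.1) (.of_forall fun y => ?_)
  by_cases hy : g y = 0
  · simp [hy]
  · rw [norm_mul]
    gcongr
    exact (abs_coord_le c i y).trans (h.g_supp y hy)

theorem eLpNorm_coord_mul_le (h : ScalarData c r R S θ g) (i : Fin n) :
    eLpNorm (fun y => coord c i y * g y) 2 volume ≤ ENNReal.ofReal R * eLpNorm g 2 volume := by
  refine eLpNorm_le_mul_eLpNorm_of_ae_le_mul (.of_forall fun y => ?_) 2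
  by_cases hy : g y = 0
  · simp [hy]
  · rw [norm_mul]
    gcongr
    exact (abs_coord_le c i y).trans (h.g_supp y hy)

/-- The coordinate difference between `y + t(x-y)` and `y` is `t(x-y)_i`. Replacing `(x-y)_i`
accordingly leaves two terms without any explicit factor `x - y`, each covered by the bounds on
`pairing`. -/
theorem integral_bogScalar_mul (h : ScalarData c r R S θ g) (hk : k + 1 ≤ n) (i : Fin n)
    (hD : MemLp D 2) (hDi : Integrable D) :
    ∫ x, bogScalar k θ i g x * D x = ∫ t in Ioi (1 : ℝ), tweight n k t / t *
      (pairing t (fun z => coord c i z * θ z) g D -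
        pairing t θ (fun y => coord c i y * g y) D) := by
  have hint := h.integrable_triple hk i hD
  have hcc : Continuous (coord c i) := (contDiff_coord c i).continuous
  calc ∫ x, bogScalar k θ i g x * D x
      = ∫ x, ∫ y, ∫ t in Ioi (1 : ℝ), tweight n k t * θ (y + t • (x - y)) *
          ((x - y) i * (D x * g y)) := by
        congr 1
        funext x
        rw [bogScalar, ← integral_mul_const]
        congr 1
        funext y
        rw [integral_mul_const, ← kernelG_eq]
        ring
    _ = ∫ p : E n × E n, ∫ t in Ioi (1 : ℝ), tweight n k t * θ (p.2 + t • (p.1 - p.2)) *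
          ((p.1 - p.2) i * (D p.1 * g p.2)) := by
        rw [Measure.volume_eq_prod, integral_prod]
        exact hint.integral_prod_left
    _ = ∫ t in Ioi (1 : ℝ), ∫ p : E n × E n, tweight n k t * θ (p.2 + t • (p.1 - p.2)) *
          ((p.1 - p.2) i * (D p.1 * g p.2)) := integral_integral_swap hint
    _ = _ := by
        refine setIntegral_congr_fun measurableSet_Ioi fun t ht => ?_
        have ht1 : (1 : ℝ) < t := ht
        have ht0 : t ≠ 0 := by linarith
        have i1 := integrable_pairing (t := t) (η := fun z => coord c i z * θ z)
          (hcc.mul h.cont) h.hasCompactSupport.mul_left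
          h.integrable hDi
        have i2 := integrable_pairing (t := t) h.cont h.hasCompactSupport
          (h.integrable_coord_mul i) hDi
        simp only [pairing]
        rw [← integral_sub i1 i2, ← integral_const_mul]
        congr 1
        funext p
        have hcoord : coord c i (p.2 + t • (p.1 - p.2)) - coord c i p.2 =
            t * (p.1 - p.2) i := by
          simp [coord]
        have : (p.1 - p.2) i = (coord c i (p.2 + t • (p.1 - p.2)) - coord c i p.2) / t := by
          rw [hcoord]
          field_simp
        rw [this]
        field_simp

end ScalarData

theorem aestronglyMeasurable_pairing (hθ : Continuous θ) (hg : AEStronglyMeasurable g)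
    (hD : AEStronglyMeasurable D) (μ : Measure ℝ) [SFinite μ] :
    AEStronglyMeasurable (fun t => pairing t θ g D) μ := by
  have hDg : AEStronglyMeasurable fun p : E n × E n => D p.1 * g p.2 :=
    hD.comp_fst.mul hg.comp_snd
  have hm : AEStronglyMeasurable (fun q : ℝ × (E n × E n) =>
      θ (q.2.2 + q.1 • (q.2.1 - q.2.2)) * (D q.2.1 * g q.2.2)) (μ.prod volume) := by
    refine AEStronglyMeasurable.mul (Continuous.aestronglyMeasurable ?_) hDg.comp_snd
    fun_prop
  exact hm.integral_prod_right'

end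

/-! ### Weak derivatives by duality -/

section

open scoped ENNReal

variable {n : ℕ} {Ω : Set (E n)}

/-- The space of test functions on `Ω`. -/
def testSpace (Ω : Set (E n)) : Submodule ℝ (E n → ℝ) where
  carrier := {φ | ContDiff ℝ ∞ φ ∧ HasCompactSupport φ ∧ tsupport φ ⊆ Ω}
  zero_mem' := ⟨contDiff_const, HasCompactSupport.zero, by simp⟩
  add_mem' := fun {φ ψ} h1 h2 => ⟨h1.1.add h2.1, h1.2.1.add h2.2.1,
    (tsupport_add φ ψ).trans (union_subset h1.2.2 h2.2.2)⟩
  smul_mem' := fun a φ h => ⟨h.1.const_smul a, h.2.1.smul_left (f := fun _ => a),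
    (tsupport_smul_subset_right (fun _ => a) φ).trans h.2.2⟩

theorem memLp_test {φ : E n → ℝ} (h : φ ∈ testSpace Ω) : MemLp φ 2 (volume.restrict Ω) :=
  (h.1.continuous.memLp_of_hasCompactSupport h.2.1).restrict _

theorem memLp_test_fderiv {φ : E n → ℝ} (h : φ ∈ testSpace Ω) (v : E n) :
    MemLp (fun x => fderiv ℝ φ x v) 2 (volume.restrict Ω) :=
  ((contDiff_fderiv_apply h.1 v).continuous.memLp_of_hasCompactSupport
    (h.2.1.fderiv_apply (𝕜 := ℝ) v)).restrict _

/-- The Riesz representation theorem for a functional that is bounded with respect to the pullback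
of a Hilbert space norm. -/
theorem exists_inner_of_bound {V H : Type*} [AddCommGroup V] [Module ℝ V] [NormedAddCommGroup H]
    [InnerProductSpace ℝ H] [CompleteSpace H] (ι : V →ₗ[ℝ] H) (Λ : V →ₗ[ℝ] ℝ) {M : ℝ} (hM : 0 ≤ M)
    (hΛ : ∀ v, |Λ v| ≤ M * ‖ι v‖) : ∃ G : H, ‖G‖ ≤ M ∧ ∀ v, Λ v = inner ℝ G (ι v) := by
  -- A merely linear section of `ι`; continuity of the induced functional on the range follows from
  -- the bound on `Λ`.
  obtain ⟨σ, hσ⟩ := ι.rangeRestrict.exists_rightInverse_of_surjective ι.range_rangeRestrict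
  have hσ' : ∀ w : LinearMap.range ι, ι (σ w) = w := fun w =>
    congrArg Subtype.val (LinearMap.congr_fun hσ w)
  let L0 : LinearMap.range ι →L[ℝ] ℝ := (Λ.comp σ).mkContinuous M fun w => by
    have := hΛ (σ w)
    rw [hσ'] at this
    exact this
  obtain ⟨L, hL, hLn⟩ := exists_extension_norm_eq (LinearMap.range ι) L0
  have hL0n : ‖L0‖ ≤ M := LinearMap.mkContinuous_norm_le _ hM _
  refine ⟨(InnerProductSpace.toDual ℝ H).symm L, ?_, fun φ => ?_⟩
  · rw [LinearIsometryEquiv.norm_map, hLn]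
    exact hL0n
  · rw [InnerProductSpace.toDual_symm_apply, hL ⟨ι φ, LinearMap.mem_range_self ι φ⟩]
    change Λ φ = Λ (σ ⟨ι φ, _⟩)
    -- The bound forces `Λ` to vanish on the kernel of `ι`, so the choice of preimage does not
    -- matter.
    have h3 := hΛ (σ ⟨ι φ, LinearMap.mem_range_self ι φ⟩ - φ)
    rw [map_sub, map_sub, hσ', sub_self, norm_zero, mul_zero] at h3
    exact (sub_eq_zero.1 (abs_nonpos_iff.1 h3)).symm

/-- A bound on the distributional derivative in the dual of `L²` makes it an `L²` function. -/
theorem exists_isWeakPartial_of_bound {f : E n → ℝ} (hf : MemLp f 2 (volume.restrict Ω))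
    (j : Fin n) {M : ℝ} (hM : 0 ≤ M)
    (h : ∀ φ ∈ testSpace Ω, |∫ x in Ω, f x * fderiv ℝ φ x (e j)| ≤
      M * (eLpNorm φ 2 (volume.restrict Ω)).toReal) :
    ∃ g, IsWeakPartial Ω j f g ∧ ∫ x in Ω, g x ^ 2 ≤ M ^ 2 := by
  set μ := volume.restrict Ω with hμ
  let ι : testSpace Ω →ₗ[ℝ] Lp ℝ 2 μ :=
    { toFun := fun φ => (memLp_test φ.2).toLp φ.1
      map_add' := fun φ ψ => rfl
      map_smul' := fun a φ => rfl }
  have hint : ∀ φ ∈ testSpace Ω, Integrable (fun x => f x * fderiv ℝ φ x (e j)) μ :=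
    fun φ hφ => hf.integrable_mul (memLp_test_fderiv hφ (e j))
  let Λ : testSpace Ω →ₗ[ℝ] ℝ :=
    { toFun := fun φ => -∫ x, f x * fderiv ℝ φ.1 x (e j) ∂μ
      map_add' := by
        intro φ ψ
        rw [← neg_add, ← integral_add (hint _ φ.2) (hint _ ψ.2)]
        congr 2
        funext x
        have := fderiv_add (φ.2.1.differentiable (by simp) x) (ψ.2.1.differentiable (by simp) x)
        rw [Submodule.coe_add, this, add_apply]
        ring
      map_smul' := by
        intro a φ
        rw [RingHom.id_apply, smul_eq_mul, mul_neg, ← integral_const_mul]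
        congr 2
        funext x
        have := fderiv_const_smul (φ.2.1.differentiable (by simp) x) a
        rw [Submodule.coe_smul, this, smul_apply, smul_eq_mul]
        ring }
  have hΛ : ∀ φ, |Λ φ| ≤ M * ‖ι φ‖ := by
    intro φ
    have h1 : ‖ι φ‖ = (eLpNorm φ.1 2 μ).toReal := Lp.norm_toLp _ (memLp_test φ.2)
    rw [h1]
    change |-_| ≤ _
    rw [abs_neg]
    exact h φ.1 φ.2
  obtain ⟨G, hGn, hGι⟩ := exists_inner_of_bound ι Λ hM hΛ
  have hGφ : ∀ φ : testSpace Ω, Λ φ = ∫ x, G x * φ.1 x ∂μ := by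
    intro φ
    rw [hGι, L2.inner_def]
    refine integral_congr_ae ?_
    filter_upwards [(memLp_test φ.2).coeFn_toLp] with x hx
    have : (ι φ : E n → ℝ) x = φ.1 x := hx
    rw [this]
    simp [mul_comm]
  refine ⟨G, ⟨Lp.memLp G, fun φ h1 h2 h3 => ?_⟩, ?_⟩
  · have := hGφ ⟨φ, h1, h2, h3⟩
    change -_ = _ at this
    rw [← this, neg_neg]
  · have h5 : ∫ x, G x ^ 2 ∂μ = ‖G‖ ^ 2 := by
      rw [← real_inner_self_eq_norm_sq, L2.inner_def]
      refine integral_congr_ae (.of_forall fun x => ?_)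
      simp [sq]
    rw [h5]
    gcongr

/-- Needed because `weakPartial` is a chosen representative: a bound proved for one weak derivative
must pass to the chosen one. Finite measure makes `L²` functions integrable, so the test function
criterion applies. -/
theorem IsWeakPartial.ae_eq (hΩ : IsOpen Ω) (hv : volume Ω ≠ ⊤) {j : Fin n} {f g g' : E n → ℝ}
    (h : IsWeakPartial Ω j f g) (h' : IsWeakPartial Ω j f g') :
    g =ᵐ[volume.restrict Ω] g' := by
  have : IsFiniteMeasure (volume.restrict Ω) := isFiniteMeasure_restrict.2 hv
  have hg : IntegrableOn g Ω := h.1.integrable (by norm_num)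
  have hg' : IntegrableOn g' Ω := h'.1.integrable (by norm_num)
  have key := hΩ.ae_eq_zero_of_integral_contDiff_smul_eq_zero (μ := volume)
    (f := fun x => g x - g' x) (hg.sub hg').locallyIntegrableOn ?_
  · rw [Filter.EventuallyEq, ae_restrict_iff' hΩ.measurableSet]
    filter_upwards [key] with x hx hxΩ
    exact sub_eq_zero.1 (hx hxΩ)
  · intro φ h1 h2 h3
    have hφ := memLp_test (Ω := Ω) ⟨h1, h2, h3⟩
    have e1 := h.2 φ h1 h2 h3
    rw [h'.2 φ h1 h2 h3, neg_inj] at e1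
    rw [← setIntegral_eq_integral_of_forall_compl_eq_zero (s := Ω)]
    · simp only [smul_eq_mul, mul_sub]
      rw [integral_sub (by exact hφ.integrable_mul h.1) (by exact hφ.integrable_mul h'.1), sub_eq_zero]
      simpa only [mul_comm] using e1.symm
    · intro x hx
      rw [image_eq_zero_of_notMem_tsupport (fun hh => hx (h3 hh)), zero_smul]

theorem integral_weakPartial_sq_le (hΩ : IsOpen Ω) (hv : volume Ω ≠ ⊤) {f : E n → ℝ}
    {j : Fin n} {M : ℝ} (h : ∃ g, IsWeakPartial Ω j f g ∧ ∫ x in Ω, g x ^ 2 ≤ M ^ 2) :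
    ∫ x in Ω, weakPartial Ω j f x ^ 2 ≤ M ^ 2 := by
  obtain ⟨g, hg, hgM⟩ := h
  have hex : ∃ g, IsWeakPartial Ω j f g := ⟨g, hg⟩
  have hae := IsWeakPartial.ae_eq hΩ hv hex.choose_spec hg
  rw [weakPartial, dif_pos hex]
  refine le_trans (le_of_eq (integral_congr_ae ?_)) hgM
  filter_upwards [hae] with x hx
  rw [hx]

end

/-! ### The derivative bound for the scalar operator -/

section

open scoped ENNReal

variable {n : ℕ} {K : (k : ℕ) → (Fin k → Fin n) → ℝ} {Ω : Set (E n)} {c : E n} {r R : ℝ}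
  {θ η g φ : E n → ℝ} {k : ℕ}

/-- A bound for the volume of the unit ball. -/
def ballConst (n : ℕ) : ℝ := max 1 (volume.real (Metric.ball (0 : E n) 1))

/-- The constant in the bound for the scalar operators. -/
def scalarConst (K : (k : ℕ) → (Fin k → Fin n) → ℝ) (k : ℕ) : ℝ :=
  pairingConst n k (ballConst n) * (4 * (n + 1) * weightConst K)

theorem scalarConst_nonneg (K : (k : ℕ) → (Fin k → Fin n) → ℝ) (k : ℕ) :
    0 ≤ scalarConst K k := by
  have := weightConst_nonneg K
  have := (pairingConst_pos n k (ballConst n)).le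
  unfold scalarConst
  positivity

theorem volume_real_ball_pos (c : E n) (hr : 0 < r) : 0 < volume.real (Metric.ball c r) :=
  ENNReal.toReal_pos (Metric.measure_ball_pos volume c hr).ne' measure_ball_lt_top.ne

theorem one_le_volume_ratio (hr : 0 < r) (hball : Metric.ball c r ⊆ Ω) (hv : volume Ω ≠ ⊤) :
    1 ≤ volume.real Ω / volume.real (Metric.ball c r) := by
  rw [one_le_div (volume_real_ball_pos c hr)]
  exact measureReal_mono hball hv

theorem volume_div_pow_le (hr : 0 < r) :
    volume.real Ω / (2 * r) ^ n ≤
      ballConst n * (volume.real Ω / volume.real (Metric.ball c r)) := by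
  have hω := volume_real_ball_pos (0 : E n) one_pos
  have h1 : volume.real (Metric.ball c r) = r ^ n * volume.real (Metric.ball (0 : E n) 1) := by
    rw [measureReal_def, Measure.addHaar_ball_of_pos volume c hr, ENNReal.toReal_mul,
      ENNReal.toReal_ofReal (by positivity), finrank_euclideanSpace_fin]
    rfl
  calc volume.real Ω / (2 * r) ^ n ≤ volume.real Ω / r ^ n := by
        gcongr
        linarith
    _ = volume.real (Metric.ball (0 : E n) 1) *
        (volume.real Ω / volume.real (Metric.ball c r)) := by
        rw [h1]
        field_simp
    _ ≤ _ := by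
        gcongr
        exact le_max_right _ _

theorem HasPairingBounds.lintegral_le {M : ℝ} (hk : k + 1 ≤ n) (hr : 0 < r)
    (hη : HasPairingBounds η M (2 * r)) (hΩ : MeasurableSet Ω) (hball : Metric.ball c r ⊆ Ω)
    (hv : volume Ω ≠ ⊤) (hg : Integrable g) (hg2 : MemLp g 2) (hgΩ : ∀ y ∉ Ω, g y = 0)
    (hφ : ContDiff ℝ ∞ φ) (hφc : HasCompactSupport φ) (j : Fin n) :
    ∫⁻ t in Ioi (1 : ℝ), ENNReal.ofReal (tweight n k t / t) *
        ‖pairing t η g (fun x => fderiv ℝ φ x (e j))‖ₑ ≤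
      ENNReal.ofReal (pairingConst n k (ballConst n) *
        (M * kappa n (k + 1) (volume.real Ω / volume.real (Metric.ball c r)))) *
        (eLpNorm g 2 volume * eLpNorm φ 2 volume) := by
  refine lintegral_pairing_le hk (ρ := 2 * r) (Q := volume.real Ω / (2 * r) ^ n) hη.nonneg
    (by linarith) (le_max_left _ _) (one_le_volume_ratio hr hball hv) (by positivity)
    (volume_div_pow_le hr) hΩ hη.smooth hη.compact hη.decay (hη.l1_fderiv j) (fun x => ?_)
    hg hg2 hgΩ hφ hφc
  have h1 := hη.sup_fderiv j x
  rw [← ofReal_norm, ← ENNReal.ofReal_toReal hv, ← ENNReal.ofReal_mul (norm_nonneg _)]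
  refine ENNReal.ofReal_le_ofReal ?_
  calc ‖fderiv ℝ η x (e j)‖ * (volume Ω).toReal ≤ M / (2 * r) ^ n * volume.real Ω := by
        exact mul_le_mul_of_nonneg_right h1 measureReal_nonneg
    _ = _ := by ring

/-- The pairing with `coord c i * θ` contributes a constant free of `ρ`. The pairing with `θ`
contributes `1/(2r)`, and its density `coord c i * g` has norm at most `R` times that of `g`;
together they give `3 + R/(2r)`. -/
theorem enorm_integral_bogScalar_fderiv_le (hk : k + 1 ≤ n) (hr : 0 < r)
    (hθ : IsWeight K c r θ) (hΩ : MeasurableSet Ω) (hball : Metric.ball c r ⊆ Ω)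
    (hv : volume Ω ≠ ⊤) (hR : 2 * r ≤ R) {S : ℝ} (hdata : ScalarData c r R S θ g)
    (hgΩ : ∀ y ∉ Ω, g y = 0) (hφ : ContDiff ℝ ∞ φ) (hφc : HasCompactSupport φ) (i j : Fin n) :
    ‖∫ x, bogScalar k θ i g x * fderiv ℝ φ x (e j)‖ₑ ≤
      ENNReal.ofReal (scalarConst K k * (R / (2 * r)) *
        kappa n (k + 1) (volume.real Ω / volume.real (Metric.ball c r))) *
        (eLpNorm g 2 volume * eLpNorm φ 2 volume) := by
  have hn : 0 < n := by omega
  set κ := kappa n (k + 1) (volume.real Ω / volume.real (Metric.ball c r)) with hκdef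
  have hκ : 1 ≤ κ := one_le_kappa n (k + 1) (one_le_volume_ratio hr hball hv)
  have hP := pairingConst_pos n k (ballConst n)
  have hS := weightConst_nonneg K
  have hR0 : 0 ≤ R := by linarith
  set D : E n → ℝ := fun x => fderiv ℝ φ x (e j) with hDdef
  have hDc : Continuous D := (contDiff_fderiv_apply hφ (e j)).continuous
  have hDs : HasCompactSupport D := hφc.fderiv_apply (𝕜 := ℝ) (e j)
  have hD2 : MemLp D 2 := hDc.memLp_of_hasCompactSupport hDs
  have hDi : Integrable D := hDc.integrable_of_hasCompactSupport hDs
  have hcc : Continuous (coord c i) := (contDiff_coord c i).continuous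
  have hcg := hdata.integrable_coord_mul i
  have hcg2le := hdata.eLpNorm_coord_mul_le i
  have hcg2 : MemLp (fun y => coord c i y * g y) 2 :=
    ⟨hcg.aestronglyMeasurable, hcg2le.trans_lt
      (ENNReal.mul_lt_top ENNReal.ofReal_lt_top hdata.memLp.2)⟩
  have b1 := (hθ.coord_mul_hasPairingBounds hn hr i).lintegral_le hk hr hΩ hball hv
    hdata.integrable hdata.memLp hgΩ hφ hφc j
  have b2 := (hθ.hasPairingBounds hn hr).lintegral_le hk hr hΩ hball hv
    hcg hcg2 (fun y hy => by simp [hgΩ y hy]) hφ hφc j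
  rw [← hκdef] at b1 b2
  rw [hdata.integral_bogScalar_mul hk i hD2 hDi]
  have hmeas : AEMeasurable (fun t => ENNReal.ofReal (tweight n k t / t) *
      ‖pairing t (fun z => coord c i z * θ z) g D‖ₑ) (volume.restrict (Ioi (1 : ℝ))) := by
    refine AEMeasurable.mul ?_ (aestronglyMeasurable_pairing (hcc.mul hdata.cont) hdata.memLp.1
      hD2.1 _).enorm
    unfold tweight
    fun_prop
  calc _ ≤ ∫⁻ t in Ioi (1 : ℝ), ‖tweight n k t / t *
        (pairing t (fun z => coord c i z * θ z) g D -
          pairing t θ (fun y => coord c i y * g y) D)‖ₑ := enorm_integral_le_lintegral_enorm _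
    _ ≤ ∫⁻ t in Ioi (1 : ℝ), (ENNReal.ofReal (tweight n k t / t) *
          ‖pairing t (fun z => coord c i z * θ z) g D‖ₑ +
        ENNReal.ofReal (tweight n k t / t) *
          ‖pairing t θ (fun y => coord c i y * g y) D‖ₑ) := by
        refine setLIntegral_mono' measurableSet_Ioi fun t ht => ?_
        have ht1 : (1 : ℝ) < t := ht
        rw [enorm_mul, Real.enorm_of_nonneg (div_nonneg (tweight_nonneg n k ht1) (by linarith)),
          ← mul_add]
        gcongr
        exact enorm_sub_le
    _ = _ + _ := lintegral_add_left' hmeas _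
    _ ≤ _ := add_le_add b1 b2
    _ ≤ ENNReal.ofReal (pairingConst n k (ballConst n) * ((n + 1) * (3 * weightConst K) * κ)) *
          (eLpNorm g 2 volume * eLpNorm φ 2 volume) +
        ENNReal.ofReal (pairingConst n k (ballConst n) *
          ((n + 1) * weightConst K / (2 * r) * κ)) *
          (ENNReal.ofReal R * eLpNorm g 2 volume * eLpNorm φ 2 volume) := by gcongr
    _ = ENNReal.ofReal (pairingConst n k (ballConst n) * ((n + 1) * weightConst K) * κ *
          (3 + R / (2 * r))) * (eLpNorm g 2 volume * eLpNorm φ 2 volume) := by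
        rw [mul_assoc (ENNReal.ofReal R), ← mul_assoc (ENNReal.ofReal _) (ENNReal.ofReal R),
          ← add_mul, ← ENNReal.ofReal_mul (by positivity),
          ← ENNReal.ofReal_add (by positivity) (by positivity)]
        congr 2
        ring
    _ ≤ _ := by
        refine mul_le_mul_left (ENNReal.ofReal_le_ofReal ?_) _
        -- As the ball's diameter is at most `R`, the `3` is absorbed: `3 + R/(2r) ≤ 4R/(2r)`.
        have hq : 1 ≤ R / (2 * r) := by rwa [one_le_div (by linarith)]
        calc _ ≤ pairingConst n k (ballConst n) * ((n + 1) * weightConst K) * κ *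
              (4 * (R / (2 * r))) := by
              gcongr
              linarith
          _ = _ := by
              rw [scalarConst]
              ring

end

/-! ### Forms and their coefficients -/

section

open scoped ENNReal

variable {n ℓ k : ℕ}

/-- Up to sign, every component of a form is zero or a coefficient on an increasing tuple. -/
theorem apply_eq_zero_or_coeff (J : Fin ℓ → Fin n) :
    (∀ w : Form n ℓ, w (fun a => e (J a)) = 0) ∨
      ∃ (I : Fin ℓ ↪o Fin n) (s : ℝ), |s| = 1 ∧
        ∀ w : Form n ℓ, w (fun a => e (J a)) = s * coeff I w := by
  by_cases hJ : Function.Injective J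
  · right
    set σ := Tuple.sort J
    have hmono : StrictMono (J ∘ σ) :=
      (Tuple.monotone_sort J).strictMono_of_injective (hJ.comp σ.injective)
    refine ⟨OrderEmbedding.ofStrictMono _ hmono, (Equiv.Perm.sign σ : ℤ), ?_, fun w => ?_⟩
    · rcases Int.units_eq_one_or (Equiv.Perm.sign σ) with h | h <;> simp [h]
    · have h := w.toAlternatingMap.map_perm (fun a => e (J a)) σ
      have h' : coeff (OrderEmbedding.ofStrictMono _ hmono) w =
          Equiv.Perm.sign σ • w (fun a => e (J a)) := h
      rw [h']
      rcases Int.units_eq_one_or (Equiv.Perm.sign σ) with h | h <;> simp [h]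
  · left
    intro w
    refine w.map_eq_zero_of_not_injective _ fun h => hJ fun a b hab => h ?_
    simp only [hab]

/-- The coefficients of a form, as a linear map. -/
def coeffMap (n ℓ : ℕ) : Form n ℓ →ₗ[ℝ] ((Fin ℓ ↪o Fin n) → ℝ) where
  toFun w I := coeff I w
  map_add' _ _ := rfl
  map_smul' _ _ := rfl

theorem coeffMap_injective (n ℓ : ℕ) : Function.Injective (coeffMap n ℓ) := by
  rw [← LinearMap.ker_eq_bot, LinearMap.ker_eq_bot']
  intro w hw
  have h : w.toAlternatingMap = 0 := by
    refine (EuclideanSpace.basisFun (Fin n) ℝ).toBasis.ext_alternating fun J _ => ?_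
    have hb : (fun a => (EuclideanSpace.basisFun (Fin n) ℝ).toBasis (J a)) =
        fun a => (e (J a) : E n) := by
      funext a
      simp [e]
    rw [hb]
    change w (fun a => e (J a)) = 0
    rcases apply_eq_zero_or_coeff (n := n) J with h0 | ⟨I, s, -, hI⟩
    · exact h0 w
    · rw [hI w, show coeff I w = 0 from congrFun hw I, mul_zero]
  exact ContinuousAlternatingMap.toAlternatingMap_injective h

theorem finiteDimensional_form (n ℓ : ℕ) : FiniteDimensional ℝ (Form n ℓ) :=
  Module.Finite.of_injective (coeffMap n ℓ) (coeffMap_injective n ℓ)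

/-- The coefficient map is injective on a finite-dimensional space, so a continuous linear left
inverse recovers the form from its coefficients. -/
theorem integrable_of_coeff {α : Type*} [MeasurableSpace α] {μ : Measure α} {f : α → Form n ℓ}
    (h : ∀ I, Integrable (fun x => coeff I (f x)) μ) : Integrable f μ := by
  have := finiteDimensional_form n ℓ
  obtain ⟨L, hL⟩ := (coeffMap n ℓ).exists_leftInverse_of_injective
    (LinearMap.ker_eq_bot.2 (coeffMap_injective n ℓ))
  have h1 : Integrable (fun x => coeffMap n ℓ (f x)) μ := Integrable.of_eval h
  have h2 := L.toContinuousLinearMap.integrable_comp h1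
  refine h2.congr (.of_forall fun x => ?_)
  exact LinearMap.congr_fun hL (f x)

theorem coeff_integral {α : Type*} [MeasurableSpace α] {μ : Measure α} {f : α → Form n ℓ}
    (h : Integrable f μ) (I : Fin ℓ ↪o Fin n) :
    coeff I (∫ x, f x ∂μ) = ∫ x, coeff I (f x) ∂μ := by
  have := finiteDimensional_form n ℓ
  exact ((((LinearMap.proj I).comp (coeffMap n ℓ)).toContinuousLinearMap).integral_comp_comm
    h).symm

/-- The multi-index `(i, I)`. -/
def consIndex (i : Fin n) (I : Fin k ↪o Fin n) : Fin (k + 1) → Fin n := Fin.cons i I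

theorem coeff_curryLeft (I : Fin k ↪o Fin n) (w : Form n (k + 1)) (z : E n) :
    coeff I (w.curryLeft z) = ∑ i, z i * w (fun a => e (consIndex i I a)) := by
  have hz : z = ∑ i, z i • (e i : E n) := by
    have := (EuclideanSpace.basisFun (Fin n) ℝ).sum_repr z
    simpa [e] using this.symm
  have hcons : ∀ i, (w.curryLeft (e i)) (fun a => e (I a)) =
      w (fun a => e (consIndex i I a)) := by
    intro i
    rw [ContinuousAlternatingMap.curryLeft_apply_apply]
    congr 1
    funext a
    refine Fin.cases ?_ (fun b => ?_) a <;> simp [consIndex]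
  conv_lhs => rw [hz]
  rw [map_sum]
  have hsum : ∀ f : Fin n → Form n k, coeff I (∑ i, f i) = ∑ i, coeff I (f i) := fun f =>
    map_sum ((LinearMap.proj I).comp (coeffMap n k)) f Finset.univ
  rw [hsum]
  refine Finset.sum_congr rfl fun i _ => ?_
  rw [map_smul, ← hcons]
  rfl

variable {Ω : Set (E n)} {u : E n → Form n ℓ}

theorem sq_integral_coeff_le (I : Fin ℓ ↪o Fin n) :
    ∫ x in Ω, coeff I (u x) ^ 2 ≤ l2Norm Ω u ^ 2 := by
  rw [l2Norm, Real.sq_sqrt (Finset.sum_nonneg fun I _ => integral_nonneg fun x => sq_nonneg _)]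
  exact Finset.single_le_sum (f := fun I => ∫ x in Ω, coeff I (u x) ^ 2)
    (fun I _ => integral_nonneg fun x => sq_nonneg _) (Finset.mem_univ I)

theorem l2Norm_nonneg : 0 ≤ l2Norm Ω u := Real.sqrt_nonneg _

theorem eLpNorm_le_ofReal_of_integral_sq_le {μ : Measure (E n)} {f : E n → ℝ} (hf : MemLp f 2 μ)
    {B : ℝ} (hB : 0 ≤ B) (h : ∫ x, f x ^ 2 ∂μ ≤ B ^ 2) : eLpNorm f 2 μ ≤ ENNReal.ofReal B := by
  refine (ENNReal.pow_le_pow_left_iff two_ne_zero).1 ?_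
  rw [eLpNorm_two_sq, ← ENNReal.ofReal_pow hB]
  have h1 : ∫⁻ x, ‖f x‖ₑ ^ 2 ∂μ = ENNReal.ofReal (∫ x, f x ^ 2 ∂μ) := by
    rw [ofReal_integral_eq_lintegral_ofReal hf.integrable_sq (.of_forall fun x => sq_nonneg _)]
    refine lintegral_congr fun x => ?_
    rw [← ofReal_norm, ← ENNReal.ofReal_pow (norm_nonneg _), Real.norm_eq_abs, sq_abs]
  rw [h1]
  exact ENNReal.ofReal_le_ofReal h

/-- Contraction produces components with index `(i, I)`, which need not be increasing; up to sign
they are zero or genuine coefficients, so the same norm controls them. -/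
theorem MemL2.memLp_apply (hu : MemL2 Ω u) (J : Fin ℓ → Fin n) :
    MemLp (fun x => u x (fun a => e (J a))) 2 (volume.restrict Ω) ∧
      eLpNorm (fun x => u x (fun a => e (J a))) 2 (volume.restrict Ω) ≤
        ENNReal.ofReal (l2Norm Ω u) := by
  rcases apply_eq_zero_or_coeff (n := n) J with h0 | ⟨I, s, hs, hI⟩
  · simp only [h0]
    exact ⟨MemLp.zero', by simp⟩
  · simp only [hI]
    have hm := (hu I).const_mul s
    refine ⟨hm, eLpNorm_le_ofReal_of_integral_sq_le hm l2Norm_nonneg ?_⟩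
    have : ∀ x, (s * coeff I (u x)) ^ 2 = coeff I (u x) ^ 2 := fun x => by
      rw [mul_pow, ← sq_abs s, hs, one_pow, one_mul]
    simp only [this]
    exact sq_integral_coeff_le I

end

/-! ### From scalar components to the operator on forms -/

section

open scoped ENNReal

variable {n k : ℕ} {K : (k : ℕ) → (Fin k → Fin n) → ℝ} {Ω : Set (E n)} {c : E n} {r : ℝ}
  {θ : E n → ℝ} {u : E n → Form n (k + 1)}

/-- The component `u_{(i, I)}`, extended by zero outside `Ω`. -/
def component (Ω : Set (E n)) (u : E n → Form n (k + 1)) (I : Fin k ↪o Fin n) (i : Fin n) :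
    E n → ℝ :=
  Ω.indicator fun y => u y (fun a => e (consIndex i I a))

theorem MemL2.component_memLp (hΩ : MeasurableSet Ω) (hu : MemL2 Ω u) (I : Fin k ↪o Fin n)
    (i : Fin n) : MemLp (component Ω u I i) 2 ∧
      eLpNorm (component Ω u I i) 2 volume ≤ ENNReal.ofReal (l2Norm Ω u) := by
  obtain ⟨h1, h2⟩ := hu.memLp_apply (consIndex i I)
  refine ⟨(memLp_indicator_iff_restrict hΩ).2 h1, ?_⟩
  rw [component, eLpNorm_indicator_eq_eLpNorm_restrict hΩ]
  exact h2

theorem scalarData_component (hΩ : MeasurableSet Ω) (hb : Bornology.IsBounded Ω) (hr : 0 < r)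
    (hball : Metric.ball c r ⊆ Ω) (hθ : IsWeight K c r θ) (hu : MemL2 Ω u) :
    ∃ S, ∀ (I : Fin k ↪o Fin n) (i : Fin n),
      ScalarData c r (Metric.diam Ω) S θ (component Ω u I i) := by
  obtain ⟨S, hS⟩ := hθ.hasCompactSupport.exists_bound_of_continuous hθ.smooth.continuous
  refine ⟨S, fun I i => ⟨hr, Metric.diam_nonneg, hθ.smooth.continuous, hθ.supp, hS,
    (hu.component_memLp hΩ I i).1, fun y hy => ?_⟩⟩
  have hyΩ : y ∈ Ω := by
    by_contra h
    exact hy (indicator_of_notMem h _)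
  rw [← dist_eq_norm]
  exact Metric.dist_le_diam_of_mem hb hyΩ (hball (Metric.mem_ball_self hr))

theorem coeff_bogIntegrand (I : Fin k ↪o Fin n) (x y : E n) :
    coeff I (bogIntegrand θ u x y) = ∑ i, kernelG (k + 1) θ x y * (x - y) i *
      u y (fun a => e (consIndex i I a)) := by
  have : coeff I (bogIntegrand θ u x y) =
      kernelG (k + 1) θ x y * coeff I ((u y).curryLeft (x - y)) := rfl
  rw [this, coeff_curryLeft, Finset.mul_sum]
  exact Finset.sum_congr rfl fun i _ => (mul_assoc _ _ _).symm

theorem indicator_coeff_bogIntegrand (I : Fin k ↪o Fin n) (x : E n) :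
    Ω.indicator (fun y => coeff I (bogIntegrand θ u x y)) =
      fun y => ∑ i, kernelG (k + 1) θ x y * (x - y) i * component Ω u I i y := by
  funext y
  by_cases hy : y ∈ Ω
  · simp only [indicator_of_mem hy, coeff_bogIntegrand, component]
  · simp [component, hy]

/-- Integrability of the form-valued integrand is what permits taking coefficients under the
integral; both hold at the points where all scalar integrands are integrable. -/
theorem ae_bogovskii (hΩ : MeasurableSet Ω) (hk : k + 1 ≤ n) {R S : ℝ}
    (hdata : ∀ (I : Fin k ↪o Fin n) (i : Fin n), ScalarData c r R S θ (component Ω u I i)) :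
    ∀ᵐ x, IntegrableOn (bogIntegrand θ u x) Ω ∧ ∀ I : Fin k ↪o Fin n,
      coeff I (bogovskii θ Ω u x) = ∑ i, bogScalar k θ i (component Ω u I i) x := by
  have h1 : ∀ᵐ x, ∀ (I : Fin k ↪o Fin n) (i : Fin n),
      Integrable fun y => kernelG (k + 1) θ x y * (x - y) i * component Ω u I i y :=
    ae_all_iff.2 fun I => ae_all_iff.2 fun i => (hdata I i).ae_integrable hk i
  filter_upwards [h1] with x hx
  have hint : IntegrableOn (bogIntegrand θ u x) Ω := by
    refine integrable_of_coeff fun I => ?_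
    rw [← IntegrableOn, ← integrable_indicator_iff hΩ, indicator_coeff_bogIntegrand]
    exact integrable_finsetSum _ fun i _ => hx I i
  refine ⟨hint, fun I => ?_⟩
  rw [bogovskii, coeff_integral hint, ← integral_indicator hΩ, indicator_coeff_bogIntegrand,
    integral_finsetSum _ fun i _ => hx I i]
  rfl

theorem abs_integral_bogovskii_fderiv_le (hk : k + 1 ≤ n) (hr : 0 < r) (hΩ : MeasurableSet Ω)
    (hb : Bornology.IsBounded Ω) (hball : Metric.ball c r ⊆ Ω) (hθ : IsWeight K c r θ)
    (hu : MemL2 Ω u) (I : Fin k ↪o Fin n) (j : Fin n) {φ : E n → ℝ} (hφ : φ ∈ testSpace Ω) :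
    |∫ x in Ω, coeff I (bogovskii θ Ω u x) * fderiv ℝ φ x (e j)| ≤
      n * (scalarConst K k * (Metric.diam Ω / (2 * r)) *
        kappa n (k + 1) (volume.real Ω / volume.real (Metric.ball c r)) * l2Norm Ω u) *
        (eLpNorm φ 2 (volume.restrict Ω)).toReal := by
  have hv : volume Ω ≠ ⊤ := hb.measure_lt_top.ne
  have hn : 0 < n := by omega
  have hR : 2 * r ≤ Metric.diam Ω := by
    rw [← diam_ball_eq hn c hr]
    exact Metric.diam_mono hball hb
  obtain ⟨S, hdata⟩ := scalarData_component (n := n) hΩ hb hr hball hθ hu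
  set A := scalarConst K k * (Metric.diam Ω / (2 * r)) *
    kappa n (k + 1) (volume.real Ω / volume.real (Metric.ball c r)) with hA
  have hA0 : 0 ≤ A := by
    have h1 := scalarConst_nonneg K k
    have h2 := one_le_kappa n (k + 1) (one_le_volume_ratio hr hball hv)
    have h3 : (0 : ℝ) ≤ Metric.diam Ω := Metric.diam_nonneg
    positivity
  have hφ0 : ∀ x ∉ Ω, φ x = 0 := fun x hx =>
    image_eq_zero_of_notMem_tsupport fun h => hx (hφ.2.2 h)
  have hD0 : ∀ x ∉ Ω, fderiv ℝ φ x (e j) = 0 := fun x hx =>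
    image_eq_zero_of_notMem_tsupport (f := fun x => fderiv ℝ φ x (e j))
      fun h => hx (hφ.2.2 (tsupport_fderiv_apply_subset' _ h))
  have hDc : MemLp (fun x => fderiv ℝ φ x (e j)) 2 :=
    (contDiff_fderiv_apply hφ.1 (e j)).continuous.memLp_of_hasCompactSupport
      (hφ.2.1.fderiv_apply (𝕜 := ℝ) (e j))
  have hφn : eLpNorm φ 2 volume = eLpNorm φ 2 (volume.restrict Ω) := by
    rw [← eLpNorm_indicator_eq_eLpNorm_restrict hΩ, indicator_eq_self.2]
    intro x hx
    by_contra h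
    exact hx (hφ0 x h)
  have hφtop : eLpNorm φ 2 (volume.restrict Ω) ≠ ⊤ := (memLp_test hφ).2.ne
  have hterm : ∀ i, |∫ x, bogScalar k θ i (component Ω u I i) x * fderiv ℝ φ x (e j)| ≤
      A * l2Norm Ω u * (eLpNorm φ 2 (volume.restrict Ω)).toReal := by
    intro i
    have h1 := enorm_integral_bogScalar_fderiv_le hk hr hθ hΩ hball hv hR (hdata I i)
      (fun y hy => indicator_of_notMem hy _) hφ.1 hφ.2.1 i j
    rw [← hA, hφn] at h1
    have h2 : ‖∫ x, bogScalar k θ i (component Ω u I i) x * fderiv ℝ φ x (e j)‖ₑ ≤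
        ENNReal.ofReal (A * l2Norm Ω u * (eLpNorm φ 2 (volume.restrict Ω)).toReal) := by
      refine h1.trans ?_
      rw [ENNReal.ofReal_mul (mul_nonneg hA0 l2Norm_nonneg), ENNReal.ofReal_mul hA0,
        ENNReal.ofReal_toReal hφtop, mul_assoc]
      gcongr
      exact (hu.component_memLp hΩ I i).2
    rw [← ofReal_norm, ENNReal.ofReal_le_ofReal_iff
      (mul_nonneg (mul_nonneg hA0 l2Norm_nonneg) ENNReal.toReal_nonneg)] at h2
    exact h2
  -- The derivative of `φ` vanishes off `Ω`, so the integral may be taken over the whole space,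
  -- where the scalar bounds are stated.
  have heq : ∫ x in Ω, coeff I (bogovskii θ Ω u x) * fderiv ℝ φ x (e j) =
      ∑ i, ∫ x, bogScalar k θ i (component Ω u I i) x * fderiv ℝ φ x (e j) := by
    rw [setIntegral_eq_integral_of_forall_compl_eq_zero fun x hx => by rw [hD0 x hx, mul_zero],
      ← integral_finsetSum]
    · refine integral_congr_ae ?_
      filter_upwards [ae_bogovskii hΩ hk hdata] with x hx
      rw [hx.2 I, Finset.sum_mul]
    · exact fun i _ => ((hdata I i).memLp_bogScalar hk i).integrable_mul hDc
  rw [heq]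
  calc _ ≤ ∑ i, |∫ x, bogScalar k θ i (component Ω u I i) x * fderiv ℝ φ x (e j)| :=
        Finset.abs_sum_le_sum_abs _ _
    _ ≤ ∑ _i : Fin n, A * l2Norm Ω u * (eLpNorm φ 2 (volume.restrict Ω)).toReal :=
        Finset.sum_le_sum fun i _ => hterm i
    _ = _ := by
        simp
        ring

end

end BogForms

end

/-! ### Assembly of the theorem -/

/-- The degree `ℓ ∈ {1, …, n}` is written `ℓ = k + 1`. The constant `C` depends only on `n`, `ℓ`
and on the constants `K` in the bounds that the weight `θ` is required to satisfy. -/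
theorem mainTheorem2 (n k : ℕ) (hk : k + 1 ≤ n) (K : (i : ℕ) → (Fin i → Fin n) → ℝ) :
    ∃ C : ℝ, 0 < C ∧
      ∀ (Ω : Set (BogForms.E n)) (c : BogForms.E n) (r : ℝ) (θ : BogForms.E n → ℝ),
        IsOpen Ω → Bornology.IsBounded Ω → 0 < r →
        BogForms.StarShapedWrt Ω (Metric.ball c r) →
        BogForms.IsWeight K c r θ →
        ∀ u : BogForms.E n → BogForms.Form n (k + 1), BogForms.MemL2 Ω u →
          (∀ᵐ x ∂(MeasureTheory.volume.restrict Ω),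
            MeasureTheory.IntegrableOn (BogForms.bogIntegrand θ u x) Ω) ∧
          BogForms.FormMemH1 Ω (BogForms.bogovskii θ Ω u) ∧
          BogForms.h1Seminorm Ω (BogForms.bogovskii θ Ω u) ≤
            C * (Metric.diam Ω / Metric.diam (Metric.ball c r)) *
              BogForms.kappa n (k + 1)
                (MeasureTheory.volume.real Ω / MeasureTheory.volume.real (Metric.ball c r)) *
              BogForms.l2Norm Ω u := by
  classical
  set N : ℝ := (Fintype.card (Fin k ↪o Fin n) : ℝ) * n with hN
  have hC0 := BogForms.scalarConst_nonneg K k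
  -- `N` counts the pairs `(I, j)` in the seminorm and `n` the scalar operators in one coefficient.
  -- The `+ 1` gives positivity when `scalarConst` is zero, as happens if the `K` of order at most
  -- two vanish.
  refine ⟨√N * (n * BogForms.scalarConst K k) + 1, by positivity, ?_⟩
  intro Ω c r θ hΩ hb hr hstar hθ u hu
  have hball := hstar.1
  have hv : volume Ω ≠ ⊤ := hb.measure_lt_top.ne
  have hn : 0 < n := by omega
  obtain ⟨S, hdata⟩ :=
    BogForms.scalarData_component hΩ.measurableSet hb hr hball hθ hu
  have hae := BogForms.ae_bogovskii hΩ.measurableSet hk hdata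
  have hκ := BogForms.one_le_kappa n (k + 1) (BogForms.one_le_volume_ratio hr hball hv)
  rw [BogForms.diam_ball_eq hn c hr]
  set κ := BogForms.kappa n (k + 1) (volume.real Ω / volume.real (Metric.ball c r)) with hκdef
  set q : ℝ := Metric.diam Ω / (2 * r) with hq
  have hq0 : 0 ≤ q := div_nonneg Metric.diam_nonneg (by linarith)
  have hl := BogForms.l2Norm_nonneg (Ω := Ω) (u := u)
  set M : ℝ := n * (BogForms.scalarConst K k * q * κ * BogForms.l2Norm Ω u) with hM
  have hM0 : 0 ≤ M := by positivity
  have hmem : ∀ I, MemLp (fun x => BogForms.coeff I (BogForms.bogovskii θ Ω u x)) 2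
      (volume.restrict Ω) := by
    intro I
    refine MemLp.ae_eq (ae_restrict_of_ae (hae.mono fun x hx => (hx.2 I).symm)) ?_
    exact (memLp_finsetSum _ fun i _ => (hdata I i).memLp_bogScalar hk i).restrict Ω
  have hweak : ∀ I j, ∃ g, BogForms.IsWeakPartial Ω j
      (fun x => BogForms.coeff I (BogForms.bogovskii θ Ω u x)) g ∧
      ∫ x in Ω, g x ^ 2 ≤ M ^ 2 := fun I j =>
    BogForms.exists_isWeakPartial_of_bound (hmem I) j hM0 fun φ hφ =>
      BogForms.abs_integral_bogovskii_fderiv_le hk hr hΩ.measurableSet hb hball hθ hu I j hφ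
  refine ⟨ae_restrict_of_ae (hae.mono fun x hx => hx.1),
    fun I => ⟨hmem I, fun j => (hweak I j).imp fun g hg => hg.1⟩, ?_⟩
  have hsum : ∑ I : Fin k ↪o Fin n, ∑ j : Fin n, ∫ x in Ω, BogForms.weakPartial Ω j
      (fun z => BogForms.coeff I (BogForms.bogovskii θ Ω u z)) x ^ 2 ≤ N * M ^ 2 := by
    calc _ ≤ ∑ _I : Fin k ↪o Fin n, ∑ _j : Fin n, M ^ 2 :=
          Finset.sum_le_sum fun I _ => Finset.sum_le_sum fun j _ =>
            BogForms.integral_weakPartial_sq_le hΩ hv (hweak I j)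
      _ = N * M ^ 2 := by
          simp [hN, mul_assoc]
  calc BogForms.h1Seminorm Ω (BogForms.bogovskii θ Ω u) ≤ √(N * M ^ 2) := Real.sqrt_le_sqrt hsum
    _ = √N * M := by rw [Real.sqrt_mul (by positivity), Real.sqrt_sq hM0]
    _ = √N * (n * BogForms.scalarConst K k) * (q * κ * BogForms.l2Norm Ω u) := by
        rw [hM]
        ring
    _ ≤ (√N * (n * BogForms.scalarConst K k) + 1) * (q * κ * BogForms.l2Norm Ω u) := by
        gcongr
        linarith
    _ = _ := by ring
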